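/- \textbf{Model.} Let $\ell\ge 1$ and let $m_0,\dots,m_{\ell+1}$ be positive integers. A ReLU network with $m_0$ inputs, $\ell$ hidden layers of $m_1,\dots,m_\ell$ nodes and $m_{\ell+1}$ outputs is a tuple $\mathcal N=(W_0,\dots,W_\ell)$ with $W_i\in[-1,1]^{m_{i+1}\times m_i}$. With $\mathrm{ReLU}(y)=\max\{0,y\}$ coordinatewise, it computes $f:\{0,1\}^{m_0}\to\{0,1\}^{m_{\ell+1}}$, $f(x)=\mathrm{sign}(\mathrm{ReLU}(f_{\ell+1}(x)))$, where $f_0(x)=x$ and $f_i(x)=W_{i-1}\cdot\mathrm{ReLU}(f_{i-1}(x))$ for $1\le i\le \ell+1$. For $\mathbf b\in\{0,1\}^{m_{\ell+1}}$, the near constant function $\mathbf b$ maps $\mathbf 0$ to $\mathbf 0$ and every $x\ne\mathbf 0$ to $\mathbf b$. The network is $(\epsilon,\delta)$-close to computing $g:\{0,1\}^{m_0}\to\{0,1\}^{m_{\ell+1}}$ if one can change each $W_i$ in at most $\epsilon m_i m_{i+1}$ entries so as to obtain a ReLU network computing a function $h$ with $\Pr_x[h(x)\ne g(x)]\le\delta$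 for uniformly random $x\in\{0,1\}^{m_0}$; otherwise it is $(\epsilon,\delta)$-far from computing $g$. A tester is a randomized adaptive algorithm that knows all the parameters, has query access to the entries of $W_0,\dots,W_\ell$, and accepts or rejects; queries are counted with multiplicity. \textbf{Theorem.} For every $\ell\ge1$ there are positive constants $c,c_1,c_2$ depending only on $\ell$ such that the following holds. Let $m_0,\dots,m_\ell\ge1$ and $m_{\ell+1}\ge2$ be integers, $\mathbf b\in\{0,1\}^{m_{\ell+1}}$, $0<\lambda<\frac1{\ell+1}$, $0<\lambda^*<\frac1{\ell+1}$, \[ 2\sqrt[\ell]{\frac{17(\ell+1)}{\max_{0\le k\le\ell}m_k}}<\epsilon<\frac12,\qquad \delta\ge 2m_{\ell+1}\bigl(\lambda^*+e^{-m_0/16}\bigr), \] and suppose that $m_k\ge c\,(2/\epsilon)^{2\ell^2}\ln\bigl(\frac1{\lambda^*}\prod_{i=1}^{\ell}m_i\bigr)$ for every $0\le k\le\ell$. Then there is a tester such that, for every ReLU network $\mathcal N$ with $m_0$ inputs, $\ell$ hidden layers of $m_1,\dots,m_\ell$ nodes and $m_{\ell+1}$ outputs: \begin{itemize} \item in every run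 on $\mathcal N$ the number $q$ of queries made satisfies $c_1\,\epsilon^{-(8\ell^2+1)}\ln^4\frac1{\lambda\epsilon}\le q\le c_2\,\epsilon^{-(8\ell^2+1)}\ln^4\frac1{\lambda\epsilon}$, i.e. $q=\Theta\bigl(\epsilon^{-(8\ell^2+1)}\ln^4\frac1{\lambda\epsilon}\bigr)$ for constant $\ell$; \item if $\mathcal N$ computes the near constant function $\mathbf b$, the tester accepts with probability at least $1-\lambda$; \item if $\mathcal N$ is $(\epsilon,\delta)$-far from computing the near constant function $\mathbf b$, the tester rejects with probability at least $1-\lambda$. \end{itemize} -/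

import Mathlib

/-- A ReLU network with `ℓ` hidden layers and layer sizes `m 0, …, m (ℓ + 1)` (inputs, hidden
layers, outputs): weight matrices `W 0, …, W ℓ`, where `W k` has `m (k + 1)` rows, `m k` columns
and entries in `[-1, 1]`. The values of `m` beyond `ℓ + 1` play no role. -/
structure ReLUNetwork (ℓ : ℕ) (m : ℕ → ℕ) where
  W : (k : Fin (ℓ + 1)) → Matrix (Fin (m (k + 1))) (Fin (m k)) ℝ
  mem_Icc : ∀ k i j, W k i j ∈ Set.Icc (-1 : ℝ) 1

/-- The positions of the weights of a network: a layer `k`, a row and a column of `W k`. -/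
abbrev WeightIndex (ℓ : ℕ) (m : ℕ → ℕ) : Type :=
  (k : Fin (ℓ + 1)) × (Fin (m (k + 1)) × Fin (m k))

namespace ReLUNetwork

/-- The coordinatewise ReLU activation function. -/
noncomputable def relu {n : ℕ} (y : Fin n → ℝ) : Fin n → ℝ := fun i => max 0 (y i)

/-- The layer values `f_i(x)`: `f_0(x) = x`, `f_{i+1}(x) = W_i · relu (f_i(x))`. -/
noncomputable def value {ℓ : ℕ} {m : ℕ → ℕ} (N : ReLUNetwork ℓ m) (x : Fin (m 0) → Bool) :
    (i : ℕ) → i ≤ ℓ + 1 → Fin (m i) → ℝ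
  | 0, _ => fun j => if x j then 1 else 0
  | i + 1, h => (N.W ⟨i, h⟩).mulVec (relu (value N x i (Nat.le_of_succ_le h)))

/-- The Boolean function computed by the network, `f(x) = sign (relu (f_{ℓ+1}(x)))`; the sign of
a nonnegative number is `0` or `1`, and `true` stands for `1`. -/
noncomputable def compute {ℓ : ℕ} {m : ℕ → ℕ} (N : ReLUNetwork ℓ m) (x : Fin (m 0) → Bool) :
    Fin (m (ℓ + 1)) → Bool :=
  fun j => decide (SignType.sign (relu (N.value x (ℓ + 1) le_rfl) j) = 1)

/-- The weight at a given position (the answer to a query). -/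
def weight {ℓ : ℕ} {m : ℕ → ℕ} (N : ReLUNetwork ℓ m) (e : WeightIndex ℓ m) : ℝ :=
  N.W e.1 e.2.1 e.2.2

/-- `N` is `(ε, δ)`-close to computing `f`: changing each `W k` in at most `ε * m k * m (k + 1)`
places one can obtain a ReLU network that differs from `f` on at most a `δ`-fraction of the
inputs. -/
def IsClose {ℓ : ℕ} {m : ℕ → ℕ} (N : ReLUNetwork ℓ m) (ε δ : ℝ)
    (f : (Fin (m 0) → Bool) → (Fin (m (ℓ + 1)) → Bool)) : Prop :=
  ∃ N' : ReLUNetwork ℓ m,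
    (∀ k : Fin (ℓ + 1),
      ((Finset.univ.filter fun p : Fin (m (k + 1)) × Fin (m k) =>
        N'.W k p.1 p.2 ≠ N.W k p.1 p.2).card : ℝ) ≤ ε * m k * m (k + 1)) ∧
    ((Finset.univ.filter fun x : Fin (m 0) → Bool => N'.compute x ≠ f x).card : ℝ)
      / (2 : ℝ) ^ m 0 ≤ δ

/-- `N` is `(ε, δ)`-far from computing `f`. -/
def IsFar {ℓ : ℕ} {m : ℕ → ℕ} (N : ReLUNetwork ℓ m) (ε δ : ℝ)
    (f : (Fin (m 0) → Bool) → (Fin (m (ℓ + 1)) → Bool)) : Prop :=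
  ¬ N.IsClose ε δ f

end ReLUNetwork

/-- The near constant function with value `b`: it maps the zero vector to the zero vector and
every other input to `b`. -/
def nearConstant {n r : ℕ} (b : Fin r → Bool) (x : Fin n → Bool) : Fin r → Bool :=
  if x = (fun _ => false) then (fun _ => false) else b

/-- Randomized adaptive query algorithms with query access to real numbers indexed by `I`.
Such an algorithm either stops and accepts (`true`) or rejects (`false`), or queries one position
and continues depending on the answer, or draws a uniformly random element of `{0, …, n}` and
continues depending on it. -/
inductive QueryAlg (I : Type) : Type
  | halt (answer : Bool) : QueryAlg I
  | query (i : I) (next : ℝ → QueryAlg I) : QueryAlg I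
  | sample (n : ℕ) (next : Fin (n + 1) → QueryAlg I) : QueryAlg I

namespace QueryAlg

/-- The joint distribution of the answer and of the number of queries made (counted with
multiplicity) when the algorithm is run on the oracle `w`. -/
noncomputable def run {I : Type} (w : I → ℝ) : QueryAlg I → PMF (Bool × ℕ)
  | halt a => PMF.pure (a, 0)
  | query i next => (run w (next (w i))).map fun p => (p.1, p.2 + 1)
  | sample n next => (PMF.uniformOfFintype (Fin (n + 1))).bind fun j => run w (next j)

/-- The probability that the algorithm gives the answer `a` on the oracle `w`. -/
noncomputable def answerProb {I : Type} (T : QueryAlg I) (w : I → ℝ) (a : Bool) : ENNReal :=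
  ((T.run w).map Prod.fst) a

end QueryAlg

/-! The engine is one sampling principle. Keep the nodes of a layer independently with equal
probability and divide sums over the layer by the expected number of kept nodes. By Chernoff's bound
the result is within `γ` of the average over the whole layer. As ReLU is 1-Lipschitz, an error `e`
becomes at most `2 * e + γ` in the next layer (`subnetValue_abs_sub_le`), and as ReLU is positively
homogeneous, the normalisation does not affect signs of outputs (`subnetValue_eq_mul_prod`). Here
`γ` is a small constant times `ε ^ ℓ`.

Repair: suppose that all but a fraction `ε / 2` of the outputs stay, on every input, below `2 ^ (ℓ +
2) * γ` in the wrong direction. Dropping a random fraction of about `ε / 4` of each hidden layer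
hardly moves the outputs on most inputs (`exists_keptNodes`). The dropped nodes are rewired into a
chain that carries the number of ones of the input to the outputs, with the sign demanded by `b` and
amplified in each layer by the number of chain nodes. On inputs with at least a quarter of ones, the
chain contributes at least `(ε / 10) ^ ℓ / 4` in normalised units, more than the remaining wrong
values; exceptional outputs listen to the chain only (`exists_planted`). Hence a far network has
many outputs that are badly wrong on some input (`isClose_of_normValue_le`).

The tester evaluates a sampled subnetwork on all subsets of the sampled inputs. If the network is
correct, each subset is a genuine input with no output on the wrong side, and the hidden samples
must be faithful to all `2 ^ (2 * s₀)` subsets at once; a hidden sample of size `s₁` of order `s₀ /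
γ ^ 2` achieves this (`freq_violation_le`). If the network is far, the sample contains a bad output;
one witness input is fixed per bad output in advance, so no exponential union bound is needed, and
its trace on the sampled inputs is among the tested subsets (`freq_noViolation_le`). Sampling needs
fewer queries than claimed, so repeated queries fill up to an exact number. -/

/-- The proportion of the elements of a finite type that satisfy `p`. -/
noncomputable def freq {Ω : Type*} [Fintype Ω] (p : Ω → Prop) : ℝ := by
  classical exact ((Finset.univ.filter p).card : ℝ) / Fintype.card Ω

/-! ### Union bound, Markov's inequality and averaging for counting probabilities -/

section Freq

variable {Ω : Type*} [Fintype Ω]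

open Classical in
theorem freq_eq_sum (p : Ω → Prop) :
    freq p = (∑ ω, if p ω then (1 : ℝ) else 0) / Fintype.card Ω := by
  simp [freq, Finset.sum_boole]

theorem freq_mono {p q : Ω → Prop} (h : ∀ ω, p ω → q ω) : freq p ≤ freq q := by
  classical
  unfold freq
  gcongr
  exact h _

theorem freq_or_le (p q : Ω → Prop) : freq (fun ω => p ω ∨ q ω) ≤ freq p + freq q := by
  classical
  unfold freq
  rw [← add_div]
  gcongr
  refine le_trans ?_ (Nat.cast_le.mpr (Finset.card_union_le _ _) |>.trans (Nat.cast_add _ _).le)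
  refine Nat.cast_le.mpr (Finset.card_le_card fun ω => ?_)
  simp

theorem freq_not [Nonempty Ω] (p : Ω → Prop) : freq (fun ω => ¬ p ω) = 1 - freq p := by
  classical
  have h := Finset.card_filter_add_card_filter_not (s := (Finset.univ : Finset Ω)) p
  have h0 : (0 : ℝ) < Fintype.card Ω := by exact_mod_cast Fintype.card_pos
  have h' : ((Finset.univ.filter p).card : ℝ) + ((Finset.univ.filter fun ω => ¬ p ω).card : ℝ)
      = Fintype.card Ω := by exact_mod_cast h
  unfold freq
  rw [eq_sub_iff_add_eq, ← add_div, add_comm, div_eq_one_iff_eq h0.ne']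
  convert h'

theorem freq_exists_mem_le {T : Type*} (F : Finset T) (E : T → Ω → Prop) {η : ℝ}
    (hE : ∀ t ∈ F, freq (E t) ≤ η) : freq (fun ω => ∃ t ∈ F, E t ω) ≤ F.card * η := by
  classical
  induction F using Finset.induction_on with
  | empty => simp [freq]
  | insert a s ha ih =>
    have h1 : freq (fun ω => ∃ t ∈ insert a s, E t ω)
        ≤ freq (E a) + freq (fun ω => ∃ t ∈ s, E t ω) := by
      refine le_trans (freq_mono fun ω => ?_) (freq_or_le _ _)
      simp [Finset.mem_insert]
    have h2 := ih fun t ht => hE t (Finset.mem_insert_of_mem ht)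
    have h3 := hE a (Finset.mem_insert_self a s)
    rw [Finset.card_insert_of_notMem ha]
    push_cast
    linarith

/-- Markov's inequality; both exponential moment arguments below end here. -/
theorem freq_le_of_sum_le [Nonempty Ω] (p : Ω → Prop) (f : Ω → ℝ) {η : ℝ} (hf : ∀ ω, 0 ≤ f ω)
    (hp : ∀ ω, p ω → 1 ≤ f ω) (hs : ∑ ω, f ω ≤ Fintype.card Ω * η) : freq p ≤ η := by
  classical
  rw [freq_eq_sum, div_le_iff₀ (by exact_mod_cast Fintype.card_pos), mul_comm]
  refine le_trans (Finset.sum_le_sum fun ω _ => ?_) hs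
  split_ifs with h
  · exact hp ω h
  · exact hf ω

/-- Double counting of the bad pairs `(y, ω)`: their proportion is at most `η`, and since at least
half of the `ω` are good, the average over good `ω` is at most `2 * η`. -/
theorem exists_freq_le {Y : Type*} [Fintype Y] [Nonempty Ω] [Nonempty Y] (good : Ω → Prop)
    (bad : Y → Ω → Prop) {η : ℝ} (hgood : freq (fun ω => ¬ good ω) ≤ 1 / 2)
    (hbad : ∀ y, freq (bad y) ≤ η) : ∃ ω, good ω ∧ freq (fun y => bad y ω) ≤ 2 * η := by
  classical
  by_contra! hcon
  have hΩ : (0 : ℝ) < Fintype.card Ω := by exact_mod_cast Fintype.card_pos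
  have hY : (0 : ℝ) < Fintype.card Y := by exact_mod_cast Fintype.card_pos
  have hη : 0 ≤ η := by
    refine le_trans ?_ (hbad (Classical.arbitrary Y))
    rw [freq]
    positivity
  have h1 : ∑ ω, (if good ω then 2 * η * Fintype.card Y else 0)
      < ∑ ω, ∑ y, if bad y ω then (1 : ℝ) else 0 := by
    have h2 : 1 / 2 ≤ freq good := by
      rw [freq_not] at hgood
      linarith
    have h3 : ∀ ω, good ω → 2 * η * Fintype.card Y < ∑ y, if bad y ω then (1 : ℝ) else 0 := by
      intro ω hω
      have := hcon ω hω
      rwa [freq_eq_sum, lt_div_iff₀ hY] at this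
    have h4 : ∃ ω, good ω := by
      by_contra! h
      simp only [freq, h, Finset.filter_false, Finset.card_empty] at h2
      norm_num at h2
    refine Finset.sum_lt_sum (fun ω _ => ?_) ?_
    · split_ifs with h
      · exact (h3 ω h).le
      · exact Finset.sum_nonneg fun y _ => by split_ifs <;> simp
    · obtain ⟨ω, hω⟩ := h4
      exact ⟨ω, Finset.mem_univ _, by rw [if_pos hω]; exact h3 ω hω⟩
  have h5 : ∑ ω, ∑ y, (if bad y ω then (1 : ℝ) else 0)
      ≤ Fintype.card Y * (η * Fintype.card Ω) := by
    rw [Finset.sum_comm, ← nsmul_eq_mul, ← Finset.card_univ, ← Finset.sum_const]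
    refine Finset.sum_le_sum fun y _ => ?_
    have := hbad y
    rwa [freq_eq_sum, div_le_iff₀ hΩ] at this
  have h6 : 1 / 2 * Fintype.card Ω ≤ ∑ ω, if good ω then (1 : ℝ) else 0 := by
    rw [freq_not, freq_eq_sum] at hgood
    rw [← le_div_iff₀ hΩ]
    linarith
  have h7 : ∑ ω, (if good ω then 2 * η * Fintype.card Y else 0)
      = 2 * η * Fintype.card Y * ∑ ω, if good ω then (1 : ℝ) else 0 := by
    rw [Finset.mul_sum]
    exact Finset.sum_congr rfl fun ω _ => by split_ifs <;> simp
  rw [h7] at h1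
  have := mul_le_mul_of_nonneg_left h6 (by positivity : 0 ≤ 2 * η * (Fintype.card Y : ℝ))
  linarith

end Freq

/-! ### Redrawing one coordinate of a product space -/

section Resample

variable {K : Type*} [Fintype K] [DecidableEq K] {Ω : K → Type*} [∀ k, Fintype (Ω k)]

/-- Exchanging the fresh value with the coordinate that it replaces is an involution on pairs. -/
theorem sum_sum_update (k : K) (f : (∀ k, Ω k) → ℝ) :
    ∑ ω, ∑ a, f (Function.update ω k a) = Fintype.card (Ω k) * ∑ ω, f ω := by
  let e : (∀ k, Ω k) × Ω k → (∀ k, Ω k) × Ω k := fun q => (Function.update q.1 k q.2, q.1 k)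
  have he : Function.Involutive e := fun q => by simp [e]
  calc ∑ ω, ∑ a, f (Function.update ω k a)
      = ∑ q : (∀ k, Ω k) × Ω k, f (e q).1 := by rw [Fintype.sum_prod_type]
    _ = ∑ q : (∀ k, Ω k) × Ω k, f q.1 :=
        Fintype.sum_bijective e he.bijective _ _ fun _ => rfl
    _ = _ := by rw [Fintype.sum_prod_type]; simp [Finset.mul_sum]

/-- An event whose frequency is at most `η` when only the coordinate `k` is drawn anew has
frequency at most `η`. -/
theorem freq_le_of_update [∀ k, Nonempty (Ω k)] (k : K) (p : (∀ k, Ω k) → Prop) {η : ℝ}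
    (h : ∀ ω, freq (fun a => p (Function.update ω k a)) ≤ η) : freq p ≤ η := by
  classical
  have h0 : (0 : ℝ) < Fintype.card (Ω k) := by exact_mod_cast Fintype.card_pos
  have h1 : (0 : ℝ) < Fintype.card (∀ k, Ω k) := by exact_mod_cast Fintype.card_pos
  have h2 := sum_sum_update k fun ω => if p ω then (1 : ℝ) else 0
  have h3 : ∑ ω : ∀ k, Ω k, ∑ a, (if p (Function.update ω k a) then (1 : ℝ) else 0)
      ≤ ∑ ω : ∀ k, Ω k, η * Fintype.card (Ω k) := by
    refine Finset.sum_le_sum fun ω _ => ?_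
    have := h ω
    rwa [freq_eq_sum, div_le_iff₀ h0] at this
  rw [h2, Finset.sum_const, Finset.card_univ, nsmul_eq_mul] at h3
  rw [freq_eq_sum, div_le_iff₀ h1]
  refine le_of_mul_le_mul_left ?_ h0
  linarith

end Resample

/-! ### Chernoff bounds for sums over kept elements -/

section Chernoff

/-- The exponential moment of a centred Bernoulli variable with parameter `r / D`, from `exp u ≤ 1 +
u + u ^ 2` for `|u| ≤ 1` and `1 + y ≤ exp y`. Keeping the factor `r / D` makes the later tail bound
depend on the expected number of kept elements rather than on the size of the layer. -/
theorem sum_exp_indicator_le {D r : ℕ} (hD : 0 < D) (hr : r ≤ D) {u : ℝ} (hu : |u| ≤ 1) :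
    ∑ d : Fin D, Real.exp (u * ((if (d : ℕ) < r then 1 else 0) - (r : ℝ) / D))
      ≤ D * Real.exp ((r : ℝ) / D * u ^ 2) := by
  have hD' : (0 : ℝ) < D := by exact_mod_cast hD
  set p : ℝ := (r : ℝ) / D with hp
  have hp0 : 0 ≤ p := by positivity
  have hpD : p * D = r := by rw [hp]; field_simp
  have hsum : ∑ d : Fin D, Real.exp (u * ((if (d : ℕ) < r then 1 else 0) - p))
      = ∑ d : Fin D, ((if (d : ℕ) < r then (1 : ℝ) else 0) * (Real.exp (u * (1 - p))
          - Real.exp (-(u * p))) + Real.exp (-(u * p))) := by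
    refine Finset.sum_congr rfl fun d _ => ?_
    split_ifs <;> ring_nf
  have hcard : ∑ d : Fin D, (if (d : ℕ) < r then (1 : ℝ) else 0) = r := by
    rw [Fin.sum_univ_eq_sum_range (fun d => if d < r then (1 : ℝ) else 0), Finset.sum_boole]
    have : (Finset.range D).filter (· < r) = Finset.range r := by
      ext d; simp; omega
    simp [this]
  rw [hsum, Finset.sum_add_distrib, ← Finset.sum_mul, hcard]
  simp only [Finset.sum_const, Finset.card_univ, Fintype.card_fin, nsmul_eq_mul]
  have h1 : Real.exp (u * (1 - p)) = Real.exp (-(u * p)) * Real.exp u := by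
    rw [← Real.exp_add]; ring_nf
  have h2 : Real.exp u - 1 ≤ u + u ^ 2 := by
    have := (abs_le.mp (Real.abs_exp_sub_one_sub_id_le hu)).2
    linarith
  have h3 : 1 + p * (Real.exp u - 1) ≤ Real.exp (p * (u + u ^ 2)) := by
    have := Real.add_one_le_exp (p * (u + u ^ 2))
    nlinarith [mul_le_mul_of_nonneg_left h2 hp0]
  calc (r : ℝ) * (Real.exp (u * (1 - p)) - Real.exp (-(u * p))) + D * Real.exp (-(u * p))
      = D * (Real.exp (-(u * p)) * (1 + p * (Real.exp u - 1))) := by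
        rw [h1, ← hpD]; ring
    _ ≤ D * (Real.exp (-(u * p)) * Real.exp (p * (u + u ^ 2))) := by gcongr
    _ = D * Real.exp (p * u ^ 2) := by rw [← Real.exp_add]; ring_nf

/-- The elements of `J` that are kept when the element `j` has drawn the number `ω j`. -/
def kept {J : Type*} [Fintype J] {D : ℕ} (r : ℕ) (ω : J → Fin D) : Finset J :=
  Finset.univ.filter fun j => (ω j : ℕ) < r

variable {J : Type*} [Fintype J] [DecidableEq J] [Nonempty J]

theorem freq_kept_upper_tail {D r : ℕ} (hD : 0 < D) (hr0 : 0 < r) (hr : r ≤ D) (a : J → ℝ)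
    (ha : ∀ j, |a j| ≤ 2) {γ : ℝ} (hγ0 : 0 ≤ γ) (hγ : γ ≤ 1) :
    freq (fun ω : J → Fin D => γ < (∑ j ∈ kept r ω, a j) / ((r : ℝ) / D * Fintype.card J)
        - (∑ j, a j) / Fintype.card J)
      ≤ Real.exp (-(γ ^ 2 * ((r : ℝ) / D * Fintype.card J) / 16)) := by
  have : Nonempty (Fin D) := ⟨⟨0, hD⟩⟩
  have hD' : (0 : ℝ) < D := by exact_mod_cast hD
  have hr' : (0 : ℝ) < r := by exact_mod_cast hr0
  set n : ℝ := (Fintype.card J : ℝ) with hn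
  have hn0 : 0 < n := by rw [hn]; exact_mod_cast Fintype.card_pos
  set p : ℝ := (r : ℝ) / D with hp
  have hp0 : 0 < p := by positivity
  -- With entries bounded by 2 the exponent is `(4 * h ^ 2 - h * γ) * p * n`; this `h` minimises it,
  -- with value `-γ ^ 2 * p * n / 16`.
  set h : ℝ := γ / 8 with hh
  let X : (J → Fin D) → ℝ := fun ω => ∑ j, a j * ((if (ω j : ℕ) < r then 1 else 0) - p)
  refine freq_le_of_sum_le _ (fun ω => Real.exp (h * X ω - h * (γ * (p * n))))
    (fun ω => (Real.exp_pos _).le) ?_ ?_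
  · intro ω hω
    refine Real.one_le_exp ?_
    have hX : X ω = (∑ j ∈ kept r ω, a j) - p * ∑ j, a j := by
      simp only [X, mul_sub, Finset.sum_sub_distrib, kept, Finset.sum_filter, mul_ite, mul_one,
        mul_zero, ← Finset.sum_mul, mul_comm p]
    have h1 : γ * (p * n) < X ω := by
      have h2 : (∑ j ∈ kept r ω, a j) / (p * n) - (∑ j, a j) / n = X ω / (p * n) := by
        rw [hX]; field_simp
      rw [h2, lt_div_iff₀ (by positivity)] at hω
      exact hω
    have h3 : 0 ≤ h := by positivity
    nlinarith
  · have h1 : ∑ ω, Real.exp (h * X ω - h * (γ * (p * n)))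
        = Real.exp (-(h * (γ * (p * n)))) *
          ∏ j : J, ∑ d : Fin D, Real.exp (h * a j * ((if (d : ℕ) < r then 1 else 0) - p)) := by
      rw [Finset.prod_univ_sum, Fintype.piFinset_univ, Finset.mul_sum]
      refine Finset.sum_congr rfl fun ω _ => ?_
      rw [← Real.exp_sum, ← Real.exp_add]
      congr 1
      simp only [X, Finset.mul_sum]
      rw [sub_eq_neg_add]
      congr 1
      exact Finset.sum_congr rfl fun j _ => by ring
    have h2 : ∀ j ∈ (Finset.univ : Finset J),
        ∑ d : Fin D, Real.exp (h * a j * ((if (d : ℕ) < r then 1 else 0) - p))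
          ≤ D * Real.exp (p * (4 * h ^ 2)) := by
      intro j _
      have hj := ha j
      have h4 : |h * a j| ≤ 1 := by
        rw [abs_mul, abs_of_nonneg (by positivity : 0 ≤ h)]
        nlinarith [abs_nonneg (a j)]
      refine (sum_exp_indicator_le hD hr h4).trans ?_
      gcongr
      have : (a j) ^ 2 ≤ 4 := by
        rw [← sq_abs]; nlinarith [abs_nonneg (a j)]
      nlinarith [sq_nonneg h]
    have h3 := Finset.prod_le_prod (fun j _ => Finset.sum_nonneg fun d _ => (Real.exp_pos
      (h * a j * ((if ((d : Fin D) : ℕ) < r then 1 else 0) - p))).le) h2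
    rw [h1]
    refine (mul_le_mul_of_nonneg_left h3 (Real.exp_pos _).le).trans (le_of_eq ?_)
    rw [Finset.prod_const, Finset.card_univ, mul_pow, ← Real.exp_nat_mul, ← hn, mul_left_comm,
      ← Real.exp_add]
    simp only [Fintype.card_pi, Fintype.card_fin, Finset.prod_const, Finset.card_univ,
      Nat.cast_pow]
    congr 2
    rw [hh]; ring

theorem freq_kept_deviation {D r : ℕ} (hD : 0 < D) (hr0 : 0 < r) (hr : r ≤ D) (a : J → ℝ)
    (ha : ∀ j, |a j| ≤ 2) {γ : ℝ} (hγ0 : 0 ≤ γ) (hγ : γ ≤ 1) :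
    freq (fun ω : J → Fin D => γ < |(∑ j ∈ kept r ω, a j) / ((r : ℝ) / D * Fintype.card J)
        - (∑ j, a j) / Fintype.card J|)
      ≤ 2 * Real.exp (-(γ ^ 2 * ((r : ℝ) / D * Fintype.card J) / 16)) := by
  have h1 := freq_kept_upper_tail hD hr0 hr a ha hγ0 hγ
  have h2 := freq_kept_upper_tail hD hr0 hr (fun j => -a j) (by simpa using ha) hγ0 hγ
  refine le_trans (freq_mono fun ω => ?_) ((freq_or_le _ _).trans ((add_le_add h1 h2).trans ?_))
  · intro h
    rcases lt_abs.mp h with h | h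
    · exact Or.inl h
    · right
      rw [Finset.sum_neg_distrib, Finset.sum_neg_distrib, neg_div, neg_div]
      linarith
  · linarith

theorem kept_eq_univ {J : Type*} [Fintype J] {D r : ℕ} (h : D ≤ r) (ω : J → Fin D) :
    kept r ω = Finset.univ := by
  simp [kept, fun j => (ω j).2.trans_le h]

end Chernoff

/-! ### Normalised subnetworks and propagation of errors -/

/-- The values at the nodes of the network with weights `W` (one matrix for each layer) in which
the nodes of layer `k` outside of `A k` are disregarded and the sums over layer `k` are divided by
`s k`. -/
noncomputable def subnetValue {m : ℕ → ℕ} (W : (k : ℕ) → Matrix (Fin (m (k + 1))) (Fin (m k)) ℝ)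
    (A : (k : ℕ) → Finset (Fin (m k))) (s : ℕ → ℝ) (x : Fin (m 0) → ℝ) :
    (k : ℕ) → Fin (m k) → ℝ
  | 0 => x
  | k + 1 => fun i => (∑ j ∈ A k, W k i j * max 0 (subnetValue W A s x k j)) / s k

/-- All nodes of all layers. -/
abbrev allNodes (m : ℕ → ℕ) (k : ℕ) : Finset (Fin (m k)) := Finset.univ

/-- The weight matrices given by an oracle, with zero matrices beyond the last layer. -/
def layerMatrix {ℓ : ℕ} {m : ℕ → ℕ} (w : WeightIndex ℓ m → ℝ) (k : ℕ) :
    Matrix (Fin (m (k + 1))) (Fin (m k)) ℝ :=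
  fun i j => if h : k < ℓ + 1 then w ⟨⟨k, h⟩, i, j⟩ else 0

section Subnet

variable {m : ℕ → ℕ} {W : (k : ℕ) → Matrix (Fin (m (k + 1))) (Fin (m k)) ℝ}
  {A : (k : ℕ) → Finset (Fin (m k))} {s n : ℕ → ℝ} {x : Fin (m 0) → ℝ}

theorem subnetValue_succ (k : ℕ) (i : Fin (m (k + 1))) : subnetValue W A s x (k + 1) i
    = (∑ j ∈ A k, W k i j * max 0 (subnetValue W A s x k j)) / s k := rfl

theorem abs_mul_max_le {c y R : ℝ} (hc : |c| ≤ 1) (hy : |y| ≤ R) : |c * max 0 y| ≤ R := by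
  have h0 : |max 0 y| ≤ R := by
    rw [abs_of_nonneg (le_max_left _ _)]
    exact max_le ((abs_nonneg y).trans hy) ((le_abs_self y).trans hy)
  rw [abs_mul]
  nlinarith [abs_nonneg c, abs_nonneg (max 0 y)]

theorem abs_sum_div_le {J : Type*} (F : Finset J) (f : J → ℝ) {R c : ℝ} (hc : 0 < c)
    (h : ∀ j ∈ F, |f j| ≤ R) : |(∑ j ∈ F, f j) / c| ≤ F.card * R / c := by
  rw [abs_div, abs_of_pos hc]
  gcongr
  refine (Finset.abs_sum_le_sum_abs _ _).trans ((Finset.sum_le_sum h).trans ?_)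
  simp

/-- The recursion is `e (k + 1) ≤ 2 * e k + γ`, where the 2 comes from the bound on the number of
kept nodes. The deviation hypothesis concerns the exact values of the full network, which do not
depend on the sample, so it can be verified layer by layer. The predicate `B` confines it to the
nodes that matter, which keeps the union bounds small. -/
theorem subnetValue_abs_sub_le {γ : ℝ} (L : ℕ) (B : (k : ℕ) → Fin (m k) → Prop)
    (hB : ∀ k < L, ∀ j ∈ A k, B k j) (hs : ∀ k < L, 0 < s k)
    (hW : ∀ k i j, |W k i j| ≤ 1) (hA : ∀ k < L, ((A k).card : ℝ) ≤ 2 * s k)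
    (hdev : ∀ k < L, ∀ i, B (k + 1) i →
      |(∑ j ∈ A k, W k i j * max 0 (subnetValue W (allNodes m) n x k j)) / s k
        - (∑ j, W k i j * max 0 (subnetValue W (allNodes m) n x k j)) / n k| ≤ γ) :
    ∀ k ≤ L, ∀ i, B k i →
      |subnetValue W A s x k i - subnetValue W (allNodes m) n x k i| ≤ (2 ^ k - 1) * γ := by
  intro k
  induction k with
  | zero => intro _ i _; simp [subnetValue]
  | succ k ih =>
    intro hk i hi
    have ih := ih (by omega)
    have hk' : k < L := by omega
    have hd := hdev k hk' i hi
    have hsk := hs k hk'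
    have hAk := hA k hk'
    set v := subnetValue W (allNodes m) n x k with hv
    set u := subnetValue W A s x k with hu
    have h1 : |(∑ j ∈ A k, W k i j * max 0 (u j)) / s k
        - (∑ j ∈ A k, W k i j * max 0 (v j)) / s k| ≤ 2 * ((2 ^ k - 1) * γ) := by
      rw [← sub_div, ← Finset.sum_sub_distrib]
      refine (abs_sum_div_le (A k) _ (R := (2 ^ k - 1) * γ) hsk ?_).trans ?_
      · intro j hj
        rw [← mul_sub, abs_mul]
        have h2 : |max 0 (u j) - max 0 (v j)| ≤ |u j - v j| := by
          simpa [max_comm] using abs_max_sub_max_le_abs (u j) (v j) 0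
        have := ih j (hB k hk' j hj)
        nlinarith [hW k i j, abs_nonneg (W k i j), abs_nonneg (max 0 (u j) - max 0 (v j))]
      · rcases (A k).eq_empty_or_nonempty with h0 | ⟨j, hj⟩
        · have h3 : 0 ≤ γ := (abs_nonneg _).trans hd
          have h4 : (1 : ℝ) ≤ 2 ^ k := one_le_pow₀ one_le_two
          have : 0 ≤ 2 * ((2 ^ k - 1) * γ) := by
            have := mul_nonneg (sub_nonneg.mpr h4) h3
            linarith
          simpa [h0] using this
        · have h3 : 0 ≤ (2 ^ k - 1) * γ := (abs_nonneg _).trans (ih j (hB k hk' j hj))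
          rw [div_le_iff₀ hsk]
          nlinarith
    have h2 := abs_sub_le ((∑ j ∈ A k, W k i j * max 0 (u j)) / s k)
      ((∑ j ∈ A k, W k i j * max 0 (v j)) / s k) ((∑ j, W k i j * max 0 (v j)) / n k)
    have h3 : (2 : ℝ) ^ (k + 1) = 2 * 2 ^ k := pow_succ' 2 k
    have h4 : |subnetValue W A s x (k + 1) i - subnetValue W (allNodes m) n x (k + 1) i|
        ≤ 2 * ((2 ^ k - 1) * γ) + γ := by
      refine h2.trans (add_le_add h1 hd)
    rw [h3]
    linarith

theorem subnetValue_succ_abs_le {R : ℝ} {k : ℕ} (hW : ∀ k i j, |W k i j| ≤ 1) (hm : 0 < m k)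
    (hn : n k = m k) (h : ∀ j, |subnetValue W (allNodes m) n x k j| ≤ R) (i : Fin (m (k + 1))) :
    |subnetValue W (allNodes m) n x (k + 1) i| ≤ R := by
  have hm' : (0 : ℝ) < m k := by exact_mod_cast hm
  refine (abs_sum_div_le Finset.univ _ (R := R) (by rw [hn]; exact hm') fun j _ =>
    abs_mul_max_le (hW k i j) (h j)).trans (le_of_eq ?_)
  rw [hn, Finset.card_univ, Fintype.card_fin]
  field_simp

/-- Positive homogeneity of ReLU lets the divisors be pulled out of all layers. -/
theorem subnetValue_eq_mul_prod {K : ℕ} (hs : ∀ k < K, 0 < s k) : ∀ k ≤ K, ∀ i,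
    subnetValue W A (fun _ => 1) x k i = (∏ t ∈ Finset.range k, s t) * subnetValue W A s x k i := by
  intro k
  induction k with
  | zero => intro _ i; simp [subnetValue]
  | succ k ih =>
    intro hk i
    have ih := ih (by omega)
    have hp : 0 ≤ ∏ t ∈ Finset.range k, s t :=
      Finset.prod_nonneg fun t ht => (hs t (by have := Finset.mem_range.mp ht; omega)).le
    have hsk := hs k (by omega)
    have h1 : ∀ j, W k i j * max 0 (subnetValue W A (fun _ => 1) x k j)
        = (∏ t ∈ Finset.range k, s t) * (W k i j * max 0 (subnetValue W A s x k j)) := by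
      intro j
      rw [ih j]
      have := mul_max_of_nonneg 0 (subnetValue W A s x k j) hp
      rw [mul_zero] at this
      rw [← this]
      ring
    simp only [subnetValue, h1, ← Finset.mul_sum, Finset.prod_range_succ]
    field_simp

/-- This is why querying the weights between sampled nodes suffices. -/
theorem subnetValue_congr {W' : (k : ℕ) → Matrix (Fin (m (k + 1))) (Fin (m k)) ℝ} (L : ℕ)
    (h : ∀ k < L, ∀ i ∈ A (k + 1), ∀ j ∈ A k, W k i j = W' k i j) :
    ∀ k ≤ L, ∀ i ∈ A k, subnetValue W A s x k i = subnetValue W' A s x k i := by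
  intro k
  induction k with
  | zero => intro _ i _; rfl
  | succ k ih =>
    intro hk i hi
    simp only [subnetValue]
    congr 1
    refine Finset.sum_congr rfl fun j hj => ?_
    rw [h k (by omega) i hi j hj, ih (by omega) j hj]

end Subnet

/-! ### Network values as unnormalised subnetwork values -/

namespace ReLUNetwork

variable {ℓ : ℕ} {m : ℕ → ℕ} (N : ReLUNetwork ℓ m)

theorem abs_layerMatrix_weight_le (k : ℕ) (i : Fin (m (k + 1))) (j : Fin (m k)) :
    |layerMatrix N.weight k i j| ≤ 1 := by
  unfold layerMatrix
  split_ifs with h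
  · exact abs_le.mpr (N.mem_Icc ⟨k, h⟩ i j)
  · simp

theorem value_eq_subnetValue (x : Fin (m 0) → Bool) : ∀ (k : ℕ) (h : k ≤ ℓ + 1) (i : Fin (m k)),
    N.value x k h i = subnetValue (layerMatrix N.weight) (allNodes m) (fun _ => 1)
      (fun j => if x j then 1 else 0) k i
  | 0, _, i => by simp [value, subnetValue]
  | k + 1, h, i => by
    have ih := value_eq_subnetValue x k (Nat.le_of_succ_le h)
    simp only [value, subnetValue, Matrix.mulVec, dotProduct, relu, div_one]
    refine Finset.sum_congr rfl fun j _ => ?_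
    rw [ih j, layerMatrix, dif_pos (Nat.lt_of_succ_le h)]
    rfl

theorem compute_eq_true_iff (x : Fin (m 0) → Bool) (j : Fin (m (ℓ + 1))) :
    N.compute x j = true ↔ 0 < N.value x (ℓ + 1) le_rfl j := by
  simp only [compute, relu, decide_eq_true_eq, sign_eq_one_iff, lt_max_iff, lt_irrefl, false_or]

theorem value_zero : ∀ (k : ℕ) (h : k ≤ ℓ + 1) (i : Fin (m k)),
    N.value (fun _ => false) k h i = 0
  | 0, _, i => by simp [value]
  | k + 1, h, i => by
    have ih := value_zero k (Nat.le_of_succ_le h)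
    simp [value, Matrix.mulVec, dotProduct, relu, ih]

end ReLUNetwork

/-! ### Random samples of nodes -/

/-- The outcomes of drawing, for every node of the layers `0, …, ℓ + 1`, a number below `D k`,
where `k` is the layer of the node. -/
abbrev NodeDraw (ℓ : ℕ) (m D : ℕ → ℕ) : Type :=
  (k : Fin (ℓ + 2)) → Fin (m k) → Fin (D k)

/-- The nodes of layer `k` that have drawn a number below `r k`. -/
def keptNodes {ℓ : ℕ} {m D : ℕ → ℕ} (r : ℕ → ℕ) (ω : NodeDraw ℓ m D) (k : ℕ) :
    Finset (Fin (m k)) :=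
  if h : k < ℓ + 2 then kept (r k) (ω ⟨k, h⟩) else ∅

/-- The expected number of nodes that are kept in layer `k`. -/
noncomputable def meanKept (m D r : ℕ → ℕ) (k : ℕ) : ℝ := (r k : ℝ) / D k * m k

section Sampling

variable {ℓ : ℕ} {m D r : ℕ → ℕ}

theorem keptNodes_update_of_ne (ω : NodeDraw ℓ m D) (k : Fin (ℓ + 2)) (a : Fin (m k) → Fin (D k))
    {k' : ℕ} (h : k' ≠ k) : keptNodes r (Function.update ω k a) k' = keptNodes r ω k' := by
  unfold keptNodes
  split_ifs with h'
  · rw [Function.update_of_ne]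
    exact fun h'' => h (congrArg Fin.val h'')
  · rfl

theorem keptNodes_update_self (ω : NodeDraw ℓ m D) (k : Fin (ℓ + 2))
    (a : Fin (m k) → Fin (D k)) :
    keptNodes r (Function.update ω k a) k = kept (r k) a := by
  simp [keptNodes]

/-- For every vector on layer `k` with entries of absolute value at most `2`, the normalised sum
over the kept nodes differs from the average over the layer by more than `γ` with frequency at
most `η`. -/
def KeepsAverages (m D r : ℕ → ℕ) (γ η : ℝ) (k : ℕ) : Prop :=
  ∀ a : Fin (m k) → ℝ, (∀ j, |a j| ≤ 2) →
    freq (fun ω : Fin (m k) → Fin (D k) =>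
      γ < |(∑ j ∈ kept (r k) ω, a j) / meanKept m D r k - (∑ j, a j) / m k|) ≤ η

theorem keepsAverages_of_lt {γ : ℝ} {k : ℕ} (hm : 0 < m k) (hr0 : 0 < r k) (hr : r k ≤ D k)
    (hγ0 : 0 ≤ γ) (hγ : γ ≤ 1) :
    KeepsAverages m D r γ (2 * Real.exp (-(γ ^ 2 * meanKept m D r k / 16))) k := by
  intro a ha
  have : Nonempty (Fin (m k)) := ⟨⟨0, hm⟩⟩
  have h := freq_kept_deviation (hr0.trans_le hr) hr0 hr a ha hγ0 hγ
  simpa only [Fintype.card_fin, meanKept] using h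

/-- A layer that is kept entirely causes no error, so layers smaller than the intended sample need
no separate treatment later. -/
theorem keepsAverages_of_eq {γ η : ℝ} {k : ℕ} (hD : 0 < D k) (hr : r k = D k)
    (hγ0 : 0 ≤ γ) (hη : 0 ≤ η) : KeepsAverages m D r γ η k := by
  intro a _
  have hD' : (D k : ℝ) ≠ 0 := by exact_mod_cast hD.ne'
  have h : ∀ ω : Fin (m k) → Fin (D k),
      ¬ γ < |(∑ j ∈ kept (r k) ω, a j) / meanKept m D r k - (∑ j, a j) / m k| := by
    intro ω
    rw [kept_eq_univ hr.ge, meanKept, hr, div_self hD', one_mul, sub_self, abs_zero]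
    exact not_lt.mpr hγ0
  simpa [freq, h] using hη

theorem KeepsAverages.mono {γ γ' η η' : ℝ} {k : ℕ} (h : KeepsAverages m D r γ η k)
    (hγ : γ ≤ γ') (hη : η ≤ η') : KeepsAverages m D r γ' η' k :=
  fun a ha => (freq_mono fun _ h' => hγ.trans_lt h').trans ((h a ha).trans hη)

/-- The vectors tested on layer `k` may be selected by the draws in the other layers: with those
fixed, `F` is a fixed finite set, and the union bound applies to the draw in layer `k` alone. -/
theorem freq_exists_deviation_le (hm : ∀ k < ℓ + 2, 0 < D k) {γ η : ℝ} (hη : 0 ≤ η) {k : ℕ}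
    (hk : k < ℓ + 2) (hav : KeepsAverages m D r γ η k) {T : Type*}
    (F : NodeDraw ℓ m D → Finset T) (a : T → Fin (m k) → ℝ) {M : ℝ}
    (hF : ∀ ω b, F (Function.update ω ⟨k, hk⟩ b) = F ω)
    (hcard : ∀ ω, ((F ω).card : ℝ) ≤ M) (ha : ∀ ω, ∀ t ∈ F ω, ∀ j, |a t j| ≤ 2) :
    freq (fun ω : NodeDraw ℓ m D => ∃ t ∈ F ω, γ <
      |(∑ j ∈ keptNodes r ω k, a t j) / meanKept m D r k - (∑ j, a t j) / m k|) ≤ M * η := by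
  have : ∀ k' : Fin (ℓ + 2), Nonempty (Fin (D k')) := fun k' => ⟨⟨0, hm k' k'.2⟩⟩
  refine freq_le_of_update ⟨k, hk⟩ _ fun ω => ?_
  have h1 : ∀ b : Fin (m k) → Fin (D k),
      keptNodes r (Function.update ω ⟨k, hk⟩ b) k = kept (r k) b :=
    fun b => keptNodes_update_self ω ⟨k, hk⟩ b
  simp only [hF, h1]
  refine (freq_exists_mem_le (F ω) (fun t b => γ < |(∑ j ∈ kept (r k) b, a t j) /
    meanKept m D r k - (∑ j, a t j) / m k|) fun t ht => hav (a t) (ha ω t ht)).trans ?_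
  exact mul_le_mul_of_nonneg_right (hcard ω) hη

/-- The number of kept nodes of layer `k` has a relative deviation of more than `γ` from its mean
with frequency at most `η`. -/
theorem freq_card_keptNodes_le (hm : ∀ k < ℓ + 2, 0 < D k) {γ η : ℝ} (hη : 0 ≤ η) {k : ℕ}
    (hk : k < ℓ + 2) (hmk : 0 < m k) (hav : KeepsAverages m D r γ η k) :
    freq (fun ω : NodeDraw ℓ m D => γ <
      |((keptNodes r ω k).card : ℝ) / meanKept m D r k - 1|) ≤ η := by
  have h := freq_exists_deviation_le hm hη hk hav (fun _ => ({()} : Finset Unit))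
    (fun _ _ => 1) (M := 1) (fun _ _ => rfl) (by simp) (by simp)
  have hmk' : (m k : ℝ) ≠ 0 := by exact_mod_cast hmk.ne'
  simpa [div_self hmk'] using h

end Sampling

/-- Chernoff with parameter 1: `(1 + exp (-1)) / 2 ≤ exp (-5 / 16)`, and `5 / 16 - 1 / 4 = 1 / 16`.
-/
theorem freq_sum_lt_quarter_le (n : ℕ) :
    freq (fun x : Fin n → Bool => (∑ j, if x j then (1 : ℝ) else 0) < n / 4)
      ≤ Real.exp (-(n : ℝ) / 16) := by
  refine freq_le_of_sum_le _
    (fun x => Real.exp (n / 4) * Real.exp (-∑ j, if x j then (1 : ℝ) else 0))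
    (fun x => by positivity) (fun x hx => ?_) ?_
  · rw [← Real.exp_add]
    exact Real.one_le_exp (by linarith)
  · have h1 : ∑ x : Fin n → Bool, Real.exp (-∑ j, if x j then (1 : ℝ) else 0)
        = (Real.exp (-1) + 1) ^ n := by
      have h2 := (Finset.prod_univ_sum (fun _ : Fin n => (Finset.univ : Finset Bool))
        fun _ y => Real.exp (-if y then (1 : ℝ) else 0)).symm
      rw [Fintype.piFinset_univ] at h2
      simp only [← Finset.sum_neg_distrib, Real.exp_sum]
      rw [h2]
      simp
    have h3 : Real.exp (-1) + 1 ≤ 2 * Real.exp (-(5 / 16)) := by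
      have h4 := Real.exp_neg_one_lt_d9
      have h5 := Real.add_one_le_exp (-(5 / 16) : ℝ)
      linarith
    rw [← Finset.mul_sum, h1]
    have h6 : (Real.exp (-1) + 1) ^ n ≤ (2 * Real.exp (-(5 / 16))) ^ n := by
      gcongr
    refine (mul_le_mul_of_nonneg_left h6 (Real.exp_pos _).le).trans (le_of_eq ?_)
    rw [mul_pow, ← Real.exp_nat_mul, mul_left_comm, ← Real.exp_add]
    simp only [Fintype.card_pi, Fintype.card_bool, Finset.prod_const, Finset.card_univ,
      Fintype.card_fin, Nat.cast_pow, Nat.cast_ofNat]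
    congr 2
    ring

/-! ### Planting a chain of nodes -/

namespace ReLUNetwork

variable {ℓ : ℕ} {m : ℕ → ℕ} (N : ReLUNetwork ℓ m)

/-- The network obtained from `N` by planting a chain of nodes: in layer `k ≥ 1` the nodes outside
of `A k` form the chain, and each of them passes its value to node `i` of the next layer with
weight `c (k + 1) i`; the other weights into the nodes outside of `R (k + 1)` are erased. The nodes
of the first layer outside of `R 1` receive all inputs with weight `c 1`. -/
noncomputable def plant (A R : (k : ℕ) → Finset (Fin (m k))) (c : (k : ℕ) → Fin (m k) → ℝ)
    (hc : ∀ k i, c k i ∈ Set.Icc (-1 : ℝ) 1) : ReLUNetwork ℓ m where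
  W k i j := if ((k : ℕ) = 0 → i ∉ R (k + 1)) ∧ ((k : ℕ) ≠ 0 → j ∉ A k) then c (k + 1) i
    else if i ∈ R (k + 1) then N.W k i j else 0
  mem_Icc k i j := by
    split_ifs
    · exact hc _ _
    · exact N.mem_Icc k i j
    · simp

/-- The value at the chain nodes of layer `k + 1` of a network obtained by planting. -/
def chainValue (A : (k : ℕ) → Finset (Fin (m k))) (t : ℝ) : ℕ → ℝ
  | 0 => t
  | k + 1 => ((A (k + 1))ᶜ.card : ℝ) * chainValue A t k

theorem chainValue_nonneg (A : (k : ℕ) → Finset (Fin (m k))) {t : ℝ} (ht : 0 ≤ t) (k : ℕ) :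
    0 ≤ chainValue A t k := by
  induction k with
  | zero => exact ht
  | succ k ih => exact mul_nonneg (Nat.cast_nonneg _) ih

theorem le_chainValue (A : (k : ℕ) → Finset (Fin (m k))) {t q : ℝ} (ht : 0 ≤ t) (hq : 0 ≤ q)
    (K : ℕ) (hA : ∀ k, 1 ≤ k → k ≤ K → q * m k ≤ ((A k)ᶜ.card : ℝ)) :
    q ^ K * (∏ k ∈ Finset.range K, (m (k + 1) : ℝ)) * t ≤ chainValue A t K := by
  induction K with
  | zero => simp [chainValue]
  | succ K ih =>
    have ih := ih fun k h1 h2 => hA k h1 (by omega)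
    rw [Finset.prod_range_succ, chainValue]
    calc q ^ (K + 1) * ((∏ k ∈ Finset.range K, (m (k + 1) : ℝ)) * m (K + 1)) * t
        = (q * m (K + 1)) * (q ^ K * (∏ k ∈ Finset.range K, (m (k + 1) : ℝ)) * t) := by ring
      _ ≤ _ := mul_le_mul (hA (K + 1) (by omega) le_rfl) ih (by positivity) (by positivity)

variable {A R : (k : ℕ) → Finset (Fin (m k))} {c : (k : ℕ) → Fin (m k) → ℝ}
  {hc : ∀ k i, c k i ∈ Set.Icc (-1 : ℝ) 1}

/-- In the hidden layers chain and surviving nodes do not interact: `c` vanishes on `A`, and the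
weights from `A` into the chain are erased. The chain value is nonnegative, so ReLU leaves it alone.
Only at the outputs do both contributions add up. -/
theorem plant_value (hA0 : A 0 = Finset.univ) (hR : ∀ k, 1 ≤ k → k ≤ ℓ → R k = A k)
    (hcA : ∀ k, 1 ≤ k → k ≤ ℓ → ∀ i, c k i = if i ∈ A k then 0 else 1) (hℓ : 1 ≤ ℓ)
    (x : Fin (m 0) → Bool) : ∀ (k : ℕ) (h : k + 1 ≤ ℓ + 1) (i : Fin (m (k + 1))),
    (N.plant A R c hc).value x (k + 1) h i
      = c (k + 1) i * chainValue A (∑ j, if x j then (1 : ℝ) else 0) k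
        + if i ∈ R (k + 1) then subnetValue (layerMatrix N.weight) A (fun _ => 1)
            (fun j => if x j then 1 else 0) (k + 1) i else 0 := by
  intro k
  set t : ℝ := ∑ j, if x j then (1 : ℝ) else 0 with ht
  have ht0 : 0 ≤ t := Finset.sum_nonneg fun j _ => by split_ifs <;> simp
  have hx : ∀ j, max 0 (if x j then (1 : ℝ) else 0) = if x j then 1 else 0 := by
    intro j; split_ifs <;> simp
  induction k with
  | zero =>
    intro h i
    have hval : (N.plant A R c hc).value x (0 + 1) h i
        = ∑ j, (if i ∉ R 1 then c 1 i else if i ∈ R 1 then N.W ⟨0, h⟩ i j else 0) *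
          if x j then 1 else 0 := by
      simp only [value, Matrix.mulVec, dotProduct, relu, hx]
      refine Finset.sum_congr rfl fun j _ => ?_
      congr 1
      change (if ((0 : ℕ) = 0 → i ∉ R 1) ∧ ((0 : ℕ) ≠ 0 → j ∉ A 0) then c 1 i
        else if i ∈ R 1 then N.W ⟨0, h⟩ i j else 0) = _
      by_cases hi : i ∈ R 1
      · rw [if_neg fun h => h.1 rfl hi, if_neg (not_not.mpr hi)]
      · rw [if_pos ⟨fun _ => hi, fun h => absurd rfl h⟩, if_pos hi]
    rw [hval]
    by_cases hi : i ∈ R 1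
    · have h0 : c 1 i = 0 := by
        rw [hcA 1 le_rfl hℓ, if_pos (by rwa [← hR 1 le_rfl hℓ])]
      simp only [hi, not_true_eq_false, if_false, if_true, zero_add, h0, zero_mul, subnetValue,
        hA0, hx, div_one]
      refine Finset.sum_congr rfl fun j _ => ?_
      rw [layerMatrix, dif_pos (Nat.succ_pos ℓ)]
      rfl
    · simp only [hi, not_false_eq_true, if_true, if_false, add_zero, chainValue, ht,
        Finset.mul_sum]
  | succ k ih =>
    intro h i
    have ih := ih (by omega)
    have hz := chainValue_nonneg A ht0 k
    have hval : (N.plant A R c hc).value x (k + 1 + 1) h i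
        = ∑ j, (if j ∉ A (k + 1) then c (k + 1 + 1) i
            else if i ∈ R (k + 1 + 1) then N.W ⟨k + 1, h⟩ i j else 0) *
          max 0 ((N.plant A R c hc).value x (k + 1) (Nat.le_of_succ_le h) j) := by
      rw [value]
      simp only [Matrix.mulVec, dotProduct, relu]
      refine Finset.sum_congr rfl fun j _ => ?_
      simp [plant]
    have hin : ∀ j, (N.plant A R c hc).value x (k + 1) (Nat.le_of_succ_le h) j
        = if j ∈ A (k + 1) then subnetValue (layerMatrix N.weight) A (fun _ => 1)
            (fun j => if x j then 1 else 0) (k + 1) j else chainValue A t k := by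
      intro j
      rw [ih, hR (k + 1) (by omega) (by omega), hcA (k + 1) (by omega) (by omega)]
      split_ifs <;> simp
    rw [hval, ← Finset.sum_compl_add_sum (A (k + 1))]
    congr 1
    · rw [chainValue, ← mul_assoc, mul_comm (c _ _), mul_assoc, ← nsmul_eq_mul,
        ← Finset.sum_const]
      refine Finset.sum_congr rfl fun j hj => ?_
      rw [Finset.mem_compl] at hj
      rw [hin, if_pos hj, if_neg hj, max_eq_right hz]
    · split_ifs with hi
      · rw [subnetValue_succ, div_one]
        refine Finset.sum_congr rfl fun j hj => ?_
        rw [hin, if_pos hj, layerMatrix, dif_pos (Nat.lt_of_succ_le h)]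
        rfl
      · refine Finset.sum_eq_zero fun j hj => ?_
        simp

/-- All changes lie in the rows outside `R (k + 1)` and the columns outside `A k`. -/
theorem plant_card_ne_le {q : ℝ}
    (hA : ∀ k ≤ ℓ, ((A k)ᶜ.card : ℝ) ≤ q * m k)
    (hR : ∀ k, 1 ≤ k → k ≤ ℓ + 1 → ((R k)ᶜ.card : ℝ) ≤ q * m k) (k : Fin (ℓ + 1)) :
    ((Finset.univ.filter fun p : Fin (m (k + 1)) × Fin (m k) =>
      (N.plant A R c hc).W k p.1 p.2 ≠ N.W k p.1 p.2).card : ℝ) ≤ 2 * q * m k * m (k + 1) := by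
  classical
  have h1 : (Finset.univ.filter fun p : Fin (m (k + 1)) × Fin (m k) =>
      (N.plant A R c hc).W k p.1 p.2 ≠ N.W k p.1 p.2)
      ⊆ (R (k + 1))ᶜ ×ˢ Finset.univ ∪ Finset.univ ×ˢ (A k)ᶜ := by
    intro p hp
    by_contra hp'
    simp only [Finset.mem_union, Finset.mem_product, Finset.mem_compl, Finset.mem_univ, and_true,
      true_and, not_or, not_not] at hp'
    refine (Finset.mem_filter.mp hp).2 ?_
    have h2 : ¬ (((k : ℕ) = 0 → p.1 ∉ R (k + 1)) ∧ ((k : ℕ) ≠ 0 → p.2 ∉ A k)) := by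
      rintro ⟨h3, h4⟩
      by_cases h0 : (k : ℕ) = 0
      · exact h3 h0 hp'.1
      · exact h4 h0 hp'.2
    simp only [plant, if_neg h2, if_pos hp'.1]
  have h2 : ((Finset.univ.filter fun p : Fin (m (k + 1)) × Fin (m k) =>
      (N.plant A R c hc).W k p.1 p.2 ≠ N.W k p.1 p.2).card : ℝ)
      ≤ (R (k + 1))ᶜ.card * m k + m (k + 1) * (A k)ᶜ.card := by
    have := (Finset.card_le_card h1).trans (Finset.card_union_le _ _)
    simp only [Finset.card_product, Finset.card_univ, Fintype.card_fin] at this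
    exact_mod_cast this
  have h3 := hA k (by omega)
  have h4 := hR (k + 1) (by omega) (by omega)
  nlinarith [mul_le_mul_of_nonneg_right h4 (Nat.cast_nonneg (α := ℝ) (m k)),
    mul_le_mul_of_nonneg_left h3 (Nat.cast_nonneg (α := ℝ) (m (k + 1)))]

end ReLUNetwork

/-! ### Wrong-side values and the effect of the chain on the outputs -/

/-- The forbidden sign of output `i`: the value of this output in a network that computes the near
constant function with value `b` is not positive after multiplication by `outSign b i`. -/
def outSign {n : ℕ} (b : Fin n → Bool) (i : Fin n) : ℝ := if b i then -1 else 1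

theorem abs_outSign {n : ℕ} (b : Fin n → Bool) (i : Fin n) : |outSign b i| = 1 := by
  unfold outSign
  split_ifs <;> simp

/-- The real vector of a Boolean vector. -/
abbrev boolVec {n : ℕ} (x : Fin n → Bool) : Fin n → ℝ := fun j => if x j then 1 else 0

namespace ReLUNetwork

variable {ℓ : ℕ} {m : ℕ → ℕ} (N : ReLUNetwork ℓ m) (b : Fin (m (ℓ + 1)) → Bool)

/-- The values at the nodes of layer `k` divided by the sizes of all preceding layers. -/
noncomputable def normValue (x : Fin (m 0) → Bool) : (k : ℕ) → Fin (m k) → ℝ :=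
  subnetValue (layerMatrix N.weight) (allNodes m) (fun k => (m k : ℝ)) (boolVec x)

theorem abs_normValue_le (hm : ∀ k ≤ ℓ, 1 ≤ m k) (x : Fin (m 0) → Bool) :
    ∀ k ≤ ℓ + 1, ∀ i, |N.normValue x k i| ≤ 1 := by
  intro k
  induction k with
  | zero =>
    intro _ i
    simp only [normValue, subnetValue, boolVec]
    split_ifs <;> simp
  | succ k ih =>
    intro hk
    exact subnetValue_succ_abs_le N.abs_layerMatrix_weight_le (hm k (by omega)) rfl
      (ih (by omega))

theorem compute_eq_nearConstant {x : Fin (m 0) → Bool} (hx : x ≠ fun _ => false)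
    (h : ∀ i, outSign b i * N.value x (ℓ + 1) le_rfl i < 0) :
    N.compute x = nearConstant b x := by
  funext i
  have hi := h i
  rw [nearConstant, if_neg hx]
  unfold outSign at hi
  cases hb : b i with
  | true =>
    rw [N.compute_eq_true_iff]
    simp only [hb, if_true] at hi
    linarith
  | false =>
    simp only [hb, Bool.false_eq_true, if_false, one_mul] at hi
    rw [← Bool.not_eq_true, N.compute_eq_true_iff]
    exact hi.not_gt

/-- Only a weak inequality is available, since a zero value also yields the Boolean output 0. It
includes the zero input, where all values vanish. -/
theorem outSign_mul_value_nonpos (h : ∀ x, N.compute x = nearConstant b x)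
    (x : Fin (m 0) → Bool) (i : Fin (m (ℓ + 1))) :
    outSign b i * N.value x (ℓ + 1) le_rfl i ≤ 0 := by
  by_cases hx : x = fun _ => false
  · rw [hx, value_zero, mul_zero]
  · have hi := congrFun (h x) i
    rw [nearConstant, if_neg hx] at hi
    unfold outSign
    cases hb : b i with
    | true =>
      rw [hb, N.compute_eq_true_iff] at hi
      simp only [if_true]
      linarith
    | false =>
      rw [hb, ← Bool.not_eq_true, N.compute_eq_true_iff] at hi
      simp only [Bool.false_eq_true, if_false]
      linarith

/-- Planting a chain with many nodes in every hidden layer fixes all outputs whose values have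
been erased or are not too far on the wrong side. -/
theorem exists_planted (hℓ : 1 ≤ ℓ) (hm : ∀ k ≤ ℓ, 1 ≤ m k) {q ε θ : ℝ} (hq : 0 < q)
    (hθ : θ < q ^ ℓ / 4) (A : (k : ℕ) → Finset (Fin (m k))) (s : ℕ → ℝ)
    (hs : ∀ k ≤ ℓ, 0 < s k ∧ s k ≤ m k) (B : Finset (Fin (m (ℓ + 1))))
    (hB : (B.card : ℝ) ≤ ε / 2 * m (ℓ + 1)) (hA0 : A 0 = Finset.univ)
    (hA : ∀ k, 1 ≤ k → k ≤ ℓ → q * m k ≤ ((A k)ᶜ.card : ℝ) ∧ ((A k)ᶜ.card : ℝ) ≤ ε / 2 * m k)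
    (hε : 0 < ε) :
    ∃ N' : ReLUNetwork ℓ m,
      (∀ k : Fin (ℓ + 1), ((Finset.univ.filter fun p : Fin (m (k + 1)) × Fin (m k) =>
        N'.W k p.1 p.2 ≠ N.W k p.1 p.2).card : ℝ) ≤ ε * m k * m (k + 1)) ∧
      ∀ x : Fin (m 0) → Bool, (m 0 : ℝ) / 4 ≤ ∑ j, boolVec x j →
        (∀ i ∉ B, outSign b i *
          subnetValue (layerMatrix N.weight) A s (boolVec x) (ℓ + 1) i ≤ θ) →
        N'.compute x = nearConstant b x := by
  classical
  -- In the hidden layers `R` agrees with `A`; at the outputs it omits `B`, so that those outputs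
  -- receive the chain only. The chain enters output `i` with weight `-outSign b i`, towards the
  -- correct side.
  let R : (k : ℕ) → Finset (Fin (m k)) := fun k => Finset.univ.filter fun i =>
    if h : k = ℓ + 1 then Fin.cast (congrArg m h) i ∉ B else i ∈ A k
  let c : (k : ℕ) → Fin (m k) → ℝ := fun k i =>
    if h : k = ℓ + 1 then -outSign b (Fin.cast (congrArg m h) i) else if i ∈ A k then 0 else 1
  have hc : ∀ k i, c k i ∈ Set.Icc (-1 : ℝ) 1 := by
    intro k i
    rw [Set.mem_Icc, ← abs_le]
    simp only [c]
    split_ifs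
    · rw [abs_neg, abs_outSign]
    · simp
    · simp
  have hR : ∀ k, 1 ≤ k → k ≤ ℓ → R k = A k := by
    intro k _ hk
    ext i
    simp [R, show k ≠ ℓ + 1 by omega]
  have hRl : R (ℓ + 1) = Bᶜ := by
    ext i
    simp [R]
  have hcA : ∀ k, 1 ≤ k → k ≤ ℓ → ∀ i, c k i = if i ∈ A k then 0 else 1 := by
    intro k _ hk i
    simp [c, show k ≠ ℓ + 1 by omega]
  have hcl : ∀ i, c (ℓ + 1) i = -outSign b i := by
    intro i
    simp [c]
  refine ⟨N.plant A R c hc, fun k => ?_, fun x hx hout => ?_⟩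
  · refine (N.plant_card_ne_le (q := ε / 2) ?_ ?_ k).trans (le_of_eq (by ring))
    · intro k hk
      rcases Nat.eq_zero_or_pos k with rfl | h0
      · rw [hA0, Finset.compl_univ, Finset.card_empty, Nat.cast_zero]
        positivity
      · exact (hA k h0 hk).2
    · intro k h0 hk
      rcases Nat.lt_or_ge ℓ k with h | h
      · obtain rfl : k = ℓ + 1 := by omega
        rw [hRl, compl_compl]
        exact hB
      · rw [hR k h0 h]
        exact (hA k h0 h).2
  · set t := ∑ j, boolVec x j with ht
    have hm0 : ∀ k ≤ ℓ, (0 : ℝ) < m k := fun k hk => by exact_mod_cast hm k hk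
    have ht0 : 0 < t := by
      have := hm0 0 (by omega)
      linarith
    refine compute_eq_nearConstant _ b ?_ fun i => ?_
    · rintro rfl
      simp [ht, boolVec] at ht0
    · rw [N.plant_value hA0 hR hcA hℓ x ℓ le_rfl i, hcl, hRl]
      have hchain := le_chainValue A ht0.le hq.le ℓ fun k h1 h2 => (hA k h1 h2).1
      have hprod : (∏ k ∈ Finset.range ℓ, (m (k + 1) : ℝ)) * m 0
          = ∏ k ∈ Finset.range (ℓ + 1), (m k : ℝ) := (Finset.prod_range_succ' (fun k => (m k : ℝ)) ℓ).symm
      have hpos : 0 < ∏ k ∈ Finset.range (ℓ + 1), (m k : ℝ) :=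
        Finset.prod_pos fun k hk => hm0 k (by have := Finset.mem_range.mp hk; omega)
      have hpos' : 0 ≤ ∏ k ∈ Finset.range ℓ, (m (k + 1) : ℝ) :=
        Finset.prod_nonneg fun k _ => Nat.cast_nonneg _
      have h1 : q ^ ℓ / 4 * ∏ k ∈ Finset.range (ℓ + 1), (m k : ℝ) ≤ chainValue A t ℓ := by
        refine le_trans ?_ hchain
        rw [← hprod]
        have := mul_le_mul_of_nonneg_left hx
          (mul_nonneg (pow_nonneg hq.le ℓ) hpos')
        linarith
      have h0 : 0 < q ^ ℓ / 4 * ∏ k ∈ Finset.range (ℓ + 1), (m k : ℝ) := by positivity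
      have h2 : outSign b i * outSign b i = 1 := by
        unfold outSign
        split_ifs <;> norm_num
      have h3 : outSign b i * (if i ∈ Bᶜ then subnetValue (layerMatrix N.weight) A (fun _ => 1)
            (boolVec x) (ℓ + 1) i else 0)
          < q ^ ℓ / 4 * ∏ k ∈ Finset.range (ℓ + 1), (m k : ℝ) := by
        split_ifs with hi
        · rw [subnetValue_eq_mul_prod (K := ℓ + 1) (fun k hk => (hs k (by omega)).1) _ le_rfl]
          have h4 := hout i (Finset.mem_compl.mp hi)
          have h5 : ∏ k ∈ Finset.range (ℓ + 1), s k ≤ ∏ k ∈ Finset.range (ℓ + 1), (m k : ℝ) :=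
            Finset.prod_le_prod
              (fun k hk => (hs k (by have := Finset.mem_range.mp hk; omega)).1.le)
              (fun k hk => (hs k (by have := Finset.mem_range.mp hk; omega)).2)
          have h6 : 0 < ∏ k ∈ Finset.range (ℓ + 1), s k :=
            Finset.prod_pos fun k hk => (hs k (by have := Finset.mem_range.mp hk; omega)).1
          have h7 : 0 < q ^ ℓ / 4 := by positivity
          rw [mul_left_comm]
          calc _ < (∏ k ∈ Finset.range (ℓ + 1), s k) * (q ^ ℓ / 4) :=
                mul_lt_mul_of_pos_left (h4.trans_lt hθ) h6
            _ ≤ (∏ k ∈ Finset.range (ℓ + 1), (m k : ℝ)) * (q ^ ℓ / 4) :=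
                mul_le_mul_of_nonneg_right h5 h7.le
            _ = _ := mul_comm _ _
        · rw [mul_zero]
          exact h0
      have h8 : outSign b i * (-outSign b i * chainValue A t ℓ) = -chainValue A t ℓ := by
        rw [← mul_assoc, mul_neg, h2]
        ring
      rw [mul_add]
      calc _ = -chainValue A t ℓ + outSign b i * (if i ∈ Bᶜ then
              subnetValue (layerMatrix N.weight) A (fun _ => 1) (boolVec x) (ℓ + 1) i else 0) := by
            rw [← h8]
        _ < 0 := by linarith

end ReLUNetwork

/-! ### Repairing a network with few bad outputs -/

namespace ReLUNetwork

variable {ℓ : ℕ} {m : ℕ → ℕ} (N : ReLUNetwork ℓ m) (b : Fin (m (ℓ + 1)) → Bool)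

/-- For a random choice of the kept nodes, the value of a given output on a given input is
probably preserved. -/
theorem freq_not_normValue_close_le (hm : ∀ k ≤ ℓ, 1 ≤ m k) {D r : ℕ → ℕ}
    (hD : ∀ k < ℓ + 2, 0 < D k) {γ η P : ℝ} (hη : 0 ≤ η)
    (hav : ∀ k ≤ ℓ, KeepsAverages m D r γ η k) (hP1 : 1 ≤ P) (hP : ∀ k, 1 ≤ k → k ≤ ℓ → m k ≤ P)
    (x : Fin (m 0) → Bool) (i : Fin (m (ℓ + 1))) :
    freq (fun ω : NodeDraw ℓ m D => (∀ k ≤ ℓ, 0 < meanKept m D r k ∧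
        ((keptNodes r ω k).card : ℝ) ≤ 2 * meanKept m D r k) ∧
      ¬ |subnetValue (layerMatrix N.weight) (keptNodes r ω) (meanKept m D r) (boolVec x) (ℓ + 1) i
        - N.normValue x (ℓ + 1) i| ≤ (2 ^ (ℓ + 1) - 1) * γ) ≤ (ℓ + 1) * (P * η) := by
  classical
  -- In the last layer only output `i` is tracked, so the failure bound does not involve `m (ℓ +
  -- 1)`.
  let F : (k : ℕ) → Finset (Fin (m (k + 1))) := fun k =>
    Finset.univ.filter fun i' => k = ℓ → (i' : ℕ) = i
  let E : ℕ → NodeDraw ℓ m D → Prop := fun k ω => ∃ i' ∈ F k, γ <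
    |(∑ j ∈ keptNodes r ω k, layerMatrix N.weight k i' j * max 0 (N.normValue x k j))
        / meanKept m D r k
      - (∑ j, layerMatrix N.weight k i' j * max 0 (N.normValue x k j)) / m k|
  have hE : ∀ k ∈ Finset.range (ℓ + 1), freq (E k) ≤ P * η := by
    intro k hk
    have hk := Finset.mem_range.mp hk
    refine freq_exists_deviation_le hD hη (by omega) (hav k (by omega)) (fun _ => F k)
      (fun i' j => layerMatrix N.weight k i' j * max 0 (N.normValue x k j)) (fun _ _ => rfl)
      (fun _ => ?_) (fun _ i' _ j => ?_)
    · rcases Nat.lt_or_ge k ℓ with h | h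
      · refine le_trans ?_ (hP (k + 1) (by omega) (by omega))
        have := Finset.card_le_univ (F k)
        rw [Fintype.card_fin] at this
        exact_mod_cast this
      · refine le_trans ?_ hP1
        have : (F k).card ≤ 1 := by
          refine Finset.card_le_one.mpr fun a ha a' ha' => Fin.ext ?_
          rw [(Finset.mem_filter.mp ha).2 (by omega), (Finset.mem_filter.mp ha').2 (by omega)]
        exact_mod_cast this
    · refine (abs_mul_max_le (N.abs_layerMatrix_weight_le k i' j)
        (N.abs_normValue_le hm x k (by omega) j)).trans one_le_two
  refine le_trans (freq_mono fun ω => ?_)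
    ((freq_exists_mem_le (Finset.range (ℓ + 1)) E hE).trans (le_of_eq (by simp)))
  rintro ⟨hω, hfar⟩
  by_contra hcon
  refine hfar (subnetValue_abs_sub_le (ℓ + 1)
    (fun k i' => if k = ℓ + 1 then (i' : ℕ) = i else True) (fun k hk j _ => ?_)
    (fun k hk => (hω k (by omega)).1) N.abs_layerMatrix_weight_le
    (fun k hk => (hω k (by omega)).2) (fun k hk i' hi' => ?_) (ℓ + 1) le_rfl i (by simp))
  · rw [if_neg (by omega)]
    trivial
  · by_contra hlt
    refine hcon ⟨k, Finset.mem_range.mpr hk, i', ?_, not_le.mp hlt⟩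
    refine Finset.mem_filter.mpr ⟨Finset.mem_univ _, fun h => ?_⟩
    rwa [if_pos (by omega)] at hi'

/-- There are sets of kept nodes that omit between `ε / 10` and `ε / 2` of every hidden layer and
preserve the values of all outputs on most inputs. -/
theorem exists_keptNodes (hℓ : 1 ≤ ℓ) (hm : ∀ k ≤ ℓ, 1 ≤ m k)
    {ε lamStar γ : ℝ} (hε : 0 < ε) (hε2 : ε < 1 / 2) (hl0 : 0 < lamStar)
    (hl1 : lamStar < 1 / ((ℓ : ℝ) + 1)) (hγ0 : 0 < γ) (hγ1 : γ ≤ ε / 10)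
    (hlarge : ∀ k ≤ ℓ, 96 * Real.log (1 / lamStar * ∏ i ∈ Finset.Icc 1 ℓ, (m i : ℝ))
      ≤ γ ^ 2 * m k) :
    ∃ (A : (k : ℕ) → Finset (Fin (m k))) (s : ℕ → ℝ), (∀ k ≤ ℓ, 0 < s k ∧ s k ≤ m k) ∧
      A 0 = Finset.univ ∧
      (∀ k, 1 ≤ k → k ≤ ℓ →
        ε / 10 * m k ≤ ((A k)ᶜ.card : ℝ) ∧ ((A k)ᶜ.card : ℝ) ≤ ε / 2 * m k) ∧
      freq (fun x : Fin (m 0) → Bool => ∃ i,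
        ¬ |subnetValue (layerMatrix N.weight) A s (boolVec x) (ℓ + 1) i
          - N.normValue x (ℓ + 1) i| ≤ (2 ^ (ℓ + 1) - 1) * γ) ≤ 2 * (m (ℓ + 1) * lamStar) := by
  classical
  set P : ℝ := ∏ i ∈ Finset.Icc 1 ℓ, (m i : ℝ) with hPdef
  have hm1 : ∀ k ≤ ℓ, (1 : ℝ) ≤ m k := fun k hk => by exact_mod_cast hm k hk
  have hP1 : 1 ≤ P := Finset.one_le_prod fun k hk => hm1 k (Finset.mem_Icc.mp hk).2
  have hPm : ∀ k, 1 ≤ k → k ≤ ℓ → (m k : ℝ) ≤ P := by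
    intro k h1 h2
    rw [hPdef, ← Finset.mul_prod_erase _ _ (Finset.mem_Icc.mpr ⟨h1, h2⟩)]
    exact le_mul_of_one_le_right (Nat.cast_nonneg _) (Finset.one_le_prod fun k hk =>
      hm1 k (Finset.mem_Icc.mp (Finset.mem_of_mem_erase hk)).2)
  have hℓ0 : (1 : ℝ) ≤ ℓ := by exact_mod_cast hℓ
  have hl2 : lamStar * (ℓ + 1) < 1 := by rwa [lt_div_iff₀ (by positivity)] at hl1
  have hl3 : lamStar < 1 / 2 := by nlinarith
  -- A hidden node is dropped with probability `1 / d`, between `ε / 5` and `ε / 4`; a deviation of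
  -- `γ ≤ ε / 10` leaves a dropped fraction between `ε / 10` and `ε / 2`. Inputs and outputs are all
  -- kept.
  set d : ℕ := ⌈4 / ε⌉₊ with hd
  have hd1 : 4 / ε ≤ d := Nat.le_ceil _
  have hd2 : (d : ℝ) ≤ 5 / ε := by
    have h1 := (Nat.ceil_lt_add_one (by positivity : 0 ≤ 4 / ε)).le
    have h2 : 1 ≤ 1 / ε := by rw [le_div_iff₀ hε]; linarith
    have h3 : 5 / ε = 4 / ε + 1 / ε := by ring
    linarith
  have hd0 : (0 : ℝ) < d := lt_of_lt_of_le (by positivity) hd1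
  have hdi1 : 1 / (d : ℝ) ≤ ε / 4 := by
    rw [div_le_iff₀ hε] at hd1
    rw [div_le_iff₀ hd0]
    linarith
  have hdi2 : ε / 5 ≤ 1 / (d : ℝ) := by
    rw [le_div_iff₀ hε] at hd2
    rw [le_div_iff₀ hd0]
    linarith
  have hd3 : 2 ≤ d := by
    have h1 : (2 : ℝ) ≤ 4 / ε := by rw [le_div_iff₀ hε]; linarith
    exact_mod_cast h1.trans hd1
  let r : ℕ → ℕ := fun k => if 1 ≤ k ∧ k ≤ ℓ then d - 1 else d
  have hrh : ∀ k, 1 ≤ k → k ≤ ℓ → meanKept m (fun _ => d) r k = (1 - 1 / (d : ℝ)) * m k := by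
    intro k h1 h2
    simp only [meanKept, r, if_pos (And.intro h1 h2), Nat.cast_sub (by omega : 1 ≤ d),
      Nat.cast_one]
    field_simp
  have hr0 : ∀ k, ¬ (1 ≤ k ∧ k ≤ ℓ) → r k = d := fun k h => if_neg h
  have hr0' : meanKept m (fun _ => d) r 0 = m 0 := by
    rw [meanKept, hr0 0 (by omega), div_self hd0.ne', one_mul]
  have hmean : ∀ k ≤ ℓ, 0 < meanKept m (fun _ => d) r k ∧ meanKept m (fun _ => d) r k ≤ m k ∧
      (m k : ℝ) ≤ 2 * meanKept m (fun _ => d) r k := by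
    intro k hk
    have h1 := hm1 k hk
    rcases Nat.eq_zero_or_pos k with rfl | h0
    · rw [hr0']
      exact ⟨by linarith, le_rfl, by linarith⟩
    · rw [hrh k h0 hk]
      have h2 : (1 : ℝ) / d ≤ 1 / 2 := by linarith
      have h3 : (0 : ℝ) < 1 / d := by positivity
      exact ⟨by nlinarith, by nlinarith, by nlinarith⟩
  -- One factor `1 / P` pays for the union over nodes, and `lamStar * (ℓ + 1) < 1` for the union
  -- over layers. The cube fits the constant 96 of `hlarge`: the mean is at least `m k / 2`, and `96
  -- = 3 * 32`.
  set η : ℝ := 2 * (lamStar / P) ^ 3 with hη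
  have hη0 : 0 ≤ η := by positivity
  have hav : ∀ k ≤ ℓ, KeepsAverages m (fun _ => d) r γ η k := by
    intro k hk
    by_cases h : 1 ≤ k ∧ k ≤ ℓ
    · have hrk : r k = d - 1 := if_pos h
      refine (keepsAverages_of_lt (hm k hk) (by rw [hrk]; omega) (hrk.trans_le (Nat.sub_le _ _)) hγ0.le
        (by linarith)).mono le_rfl ?_
      rw [hη]
      gcongr
      have h1 : lamStar / P = Real.exp (-Real.log (1 / lamStar * P)) := by
        rw [← Real.log_inv, Real.exp_log (by positivity)]
        field_simp
      rw [h1, ← Real.exp_nat_mul, Real.exp_le_exp]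
      have h2 := hlarge k hk
      have h3 := (hmean k hk).2.2
      have h4 := mul_le_mul_of_nonneg_left h3 (sq_nonneg γ)
      push_cast
      linarith
    · exact keepsAverages_of_eq (show 0 < d by omega) (hr0 k h) hγ0.le hη0
  have : Nonempty (NodeDraw ℓ m fun _ => d) := ⟨fun _ _ => ⟨0, by change 0 < d; omega⟩⟩
  have hηℓ : ((ℓ : ℝ) + 1) * (P * η) ≤ lamStar := by
    have h1 : ((ℓ : ℝ) + 1) * (P * η) = 2 * (lamStar * (ℓ + 1)) * lamStar * lamStar / P ^ 2 := by
      rw [hη]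
      field_simp
    rw [h1, div_le_iff₀ (by positivity)]
    have h2 : 1 ≤ P ^ 2 := one_le_pow₀ hP1
    have h3 : 2 * (lamStar * (ℓ + 1)) * lamStar ≤ 1 := by nlinarith
    nlinarith [mul_le_mul_of_nonneg_right h3 hl0.le]
  obtain ⟨ω, hgood, hbad⟩ := exists_freq_le
    (good := fun ω : NodeDraw ℓ m (fun _ => d) => ∀ k ∈ Finset.range (ℓ + 1),
      |((keptNodes r ω k).card : ℝ) / meanKept m (fun _ => d) r k - 1| ≤ γ)
    (bad := fun (x : Fin (m 0) → Bool) ω => ∃ i ∈ (Finset.univ : Finset (Fin (m (ℓ + 1)))),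
      (∀ k ≤ ℓ, 0 < meanKept m (fun _ => d) r k ∧
        ((keptNodes r ω k).card : ℝ) ≤ 2 * meanKept m (fun _ => d) r k) ∧
      ¬ |subnetValue (layerMatrix N.weight) (keptNodes r ω) (meanKept m (fun _ => d) r)
          (boolVec x) (ℓ + 1) i - N.normValue x (ℓ + 1) i| ≤ (2 ^ (ℓ + 1) - 1) * γ)
    (η := m (ℓ + 1) * lamStar) (by
      have h1 := freq_exists_mem_le (Finset.range (ℓ + 1))
        (fun k (ω : NodeDraw ℓ m fun _ => d) =>
          γ < |((keptNodes r ω k).card : ℝ) / meanKept m (fun _ => d) r k - 1|) (η := η)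
        (fun k hk => freq_card_keptNodes_le (fun _ _ => by omega) hη0
          (by have := Finset.mem_range.mp hk; omega) (hm k (by have := Finset.mem_range.mp hk; omega))
          (hav k (by have := Finset.mem_range.mp hk; omega)))
      refine (freq_mono fun ω h => ?_).trans (h1.trans ?_)
      · simpa only [not_forall, exists_prop, not_le] using h
      · rw [Finset.card_range]
        push_cast
        have h2 : ((ℓ : ℝ) + 1) * η ≤ (ℓ + 1) * (P * η) := by
          gcongr
          nlinarith
        linarith)
    (fun x => by
      refine (freq_exists_mem_le Finset.univ _ fun i _ => (N.freq_not_normValue_close_le hm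
        (fun _ _ => by omega) hη0 hav hP1 hPm x i).trans hηℓ).trans (le_of_eq ?_)
      rw [Finset.card_univ, Fintype.card_fin])
  have hA0 : keptNodes r ω 0 = Finset.univ := by
    rw [keptNodes, dif_pos (by omega)]
    exact kept_eq_univ (hr0 0 (by omega)).ge _
  have hA : ∀ k, 1 ≤ k → k ≤ ℓ → ε / 10 * m k ≤ ((keptNodes r ω k)ᶜ.card : ℝ) ∧
      ((keptNodes r ω k)ᶜ.card : ℝ) ≤ ε / 2 * m k := by
    intro k h1 h2
    have h3 := abs_le.mp (hgood k (Finset.mem_range.mpr (by omega)))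
    have h4 : ((keptNodes r ω k)ᶜ.card : ℝ) = m k - (keptNodes r ω k).card := by
      have := Finset.card_add_card_compl (keptNodes r ω k)
      rw [Fintype.card_fin] at this
      rw [eq_sub_iff_add_eq, add_comm]
      exact_mod_cast this
    have hpos := (hmean k h2).1
    have hle := (hmean k h2).2.1
    have h5 : (1 - γ) * meanKept m (fun _ => d) r k ≤ (keptNodes r ω k).card := by
      rw [← le_div_iff₀ hpos]
      linarith
    have h6 : ((keptNodes r ω k).card : ℝ) ≤ (1 + γ) * meanKept m (fun _ => d) r k := by
      rw [← div_le_iff₀ hpos]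
      linarith
    have h7 := mul_le_mul_of_nonneg_left hle hγ0.le
    have h8 : meanKept m (fun _ => d) r k = m k - 1 / (d : ℝ) * m k := by
      rw [hrh k h1 h2]
      ring
    have hmk : (0 : ℝ) ≤ m k := Nat.cast_nonneg _
    have h9 := mul_le_mul_of_nonneg_right hdi1 hmk
    have h10 := mul_le_mul_of_nonneg_right hdi2 hmk
    have h11 := mul_le_mul_of_nonneg_right hγ1 hmk
    rw [h4]
    constructor <;> linarith
  refine ⟨keptNodes r ω, meanKept m (fun _ => d) r,
    fun k hk => ⟨(hmean k hk).1, (hmean k hk).2.1⟩, hA0, hA, (freq_mono fun x hx => ?_).trans hbad⟩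
  obtain ⟨i, hi⟩ := hx
  refine ⟨i, Finset.mem_univ _, fun k hk => ⟨(hmean k hk).1, ?_⟩, hi⟩
  refine le_trans ?_ (hmean k hk).2.2
  have := Finset.card_le_univ (keptNodes r ω k)
  rw [Fintype.card_fin] at this
  exact_mod_cast this

/-- If all outputs with few exceptions are nowhere far on the wrong side, then the network is
close to computing the near constant function. -/
theorem isClose_of_normValue_le (hℓ : 1 ≤ ℓ) (hm : ∀ k ≤ ℓ, 1 ≤ m k) (hm' : 1 ≤ m (ℓ + 1))
    {ε δ lamStar γ : ℝ} (hε : 0 < ε) (hε2 : ε < 1 / 2) (hl0 : 0 < lamStar)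
    (hl1 : lamStar < 1 / ((ℓ : ℝ) + 1))
    (hδ : 2 * (m (ℓ + 1) : ℝ) * (lamStar + Real.exp (-(m 0 : ℝ) / 16)) ≤ δ)
    (hγ0 : 0 < γ) (hγ1 : γ ≤ ε / 10) (hγ2 : 2 ^ (ℓ + 3) * γ < (ε / 10) ^ ℓ / 4)
    (hlarge : ∀ k ≤ ℓ, 96 * Real.log (1 / lamStar * ∏ i ∈ Finset.Icc 1 ℓ, (m i : ℝ))
      ≤ γ ^ 2 * m k)
    (B : Finset (Fin (m (ℓ + 1)))) (hB : (B.card : ℝ) ≤ ε / 2 * m (ℓ + 1))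
    (hv : ∀ i ∉ B, ∀ x, outSign b i * N.normValue x (ℓ + 1) i ≤ 2 ^ (ℓ + 2) * γ) :
    N.IsClose ε δ (nearConstant b) := by
  classical
  obtain ⟨A, s, hs, hA0, hA, hbad⟩ := N.exists_keptNodes hℓ hm hε hε2 hl0 hl1 hγ0 hγ1 hlarge
  obtain ⟨N', hN', hcomp⟩ := N.exists_planted b hℓ hm (q := ε / 10) (ε := ε)
    (θ := 2 ^ (ℓ + 3) * γ) (by positivity) hγ2 A s hs B hB hA0 hA hε
  refine ⟨N', hN', ?_⟩
  have hfreq : ((Finset.univ.filter fun x : Fin (m 0) → Bool =>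
      N'.compute x ≠ nearConstant b x).card : ℝ) / (2 : ℝ) ^ m 0
      = freq fun x : Fin (m 0) → Bool => N'.compute x ≠ nearConstant b x := by
    unfold freq
    simp only [Fintype.card_pi, Fintype.card_bool, Finset.prod_const, Finset.card_univ,
      Fintype.card_fin, Nat.cast_pow, Nat.cast_ofNat]
    congr!
  rw [hfreq]
  -- An input is lost only if it has too few ones for the chain or some output moves too far when
  -- nodes are dropped.
  refine (freq_mono (q := fun x => _ ∨ _) fun x hx => ?_).trans ((freq_or_le _ _).trans
    ((add_le_add (freq_sum_lt_quarter_le (m 0)) hbad).trans ?_))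
  · by_contra hcon
    obtain ⟨hsum, hok⟩ := not_or.mp hcon
    refine hx (hcomp x (not_lt.mp hsum) fun i hi => ?_)
    have h1 : |subnetValue (layerMatrix N.weight) A s (boolVec x) (ℓ + 1) i - N.normValue x (ℓ + 1) i| ≤ (2 ^ (ℓ + 1) - 1) * γ := by
      by_contra h
      exact hok ⟨i, h⟩
    have h2 := hv i hi x
    have h3 : outSign b i * (subnetValue (layerMatrix N.weight) A s (boolVec x) (ℓ + 1) i - N.normValue x (ℓ + 1) i)
        ≤ (2 ^ (ℓ + 1) - 1) * γ := by
      refine (le_abs_self _).trans ?_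
      rw [abs_mul, abs_outSign, one_mul]
      exact h1
    have h4 : (2 : ℝ) ^ (ℓ + 3) = 4 * 2 ^ (ℓ + 1) := by ring
    have h5 : (2 : ℝ) ^ (ℓ + 2) = 2 * 2 ^ (ℓ + 1) := by ring
    rw [h5] at h2
    rw [h4]
    have h6 : 0 < 2 ^ (ℓ + 1) * γ := by positivity
    linarith
  · have h1 : (1 : ℝ) ≤ m (ℓ + 1) := by exact_mod_cast hm'
    have h2 := le_mul_of_one_le_left (Real.exp_pos (-(m 0 : ℝ) / 16)).le h1
    have h3 := Real.exp_pos (-(m 0 : ℝ) / 16)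
    refine le_trans ?_ hδ
    rw [mul_add]
    linarith

end ReLUNetwork

/-! ### Nonadaptive query algorithms and their acceptance probabilities -/

namespace QueryAlg

variable {I : Type}

/-- Query all positions of a list and decide by `φ` from the answers; positions that are not
queried keep the value that they have in `acc`. -/
def queryList [DecidableEq I] (φ : (I → ℝ) → Bool) : List I → (I → ℝ) → QueryAlg I
  | [], acc => halt (φ acc)
  | e :: L, acc => query e fun r => queryList φ L (Function.update acc e r)

theorem run_queryList [DecidableEq I] (φ : (I → ℝ) → Bool) (w : I → ℝ) (L : List I) :
    ∀ acc : I → ℝ, (queryList φ L acc).run w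
      = PMF.pure (φ fun e => if e ∈ L then w e else acc e, L.length) := by
  induction L with
  | nil => intro acc; simp [queryList, run]
  | cons e L ih =>
    intro acc
    rw [queryList, run, ih, PMF.pure_map]
    refine congrArg PMF.pure (Prod.ext (congrArg φ (funext fun e' => ?_)) (by simp))
    by_cases h : e' ∈ L
    · simp [h]
    · by_cases h' : e' = e
      · subst h'
        simp [h]
      · simp [h, h']

/-- Draw a uniformly random element of a finite type and continue depending on it. -/
noncomputable def sampleThen {Ω : Type*} [Fintype Ω] [Nonempty Ω] (T : Ω → QueryAlg I) :
    QueryAlg I :=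
  sample (Fintype.card Ω - 1) fun j =>
    T ((Fintype.equivFin Ω).symm (Fin.cast (Nat.succ_pred_eq_of_pos Fintype.card_pos) j))

variable {Ω : Type*} [Fintype Ω] [Nonempty Ω] {T : Ω → QueryAlg I} {w : I → ℝ} {q : ℕ}
  {ans : Ω → Bool}

theorem snd_eq_of_mem_support_run_sampleThen (h : ∀ ω, (T ω).run w = PMF.pure (ans ω, q))
    {p : Bool × ℕ} (hp : p ∈ ((sampleThen T).run w).support) : p.2 = q := by
  rw [sampleThen, run, PMF.mem_support_bind_iff] at hp
  obtain ⟨j, _, hj⟩ := hp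
  rw [h, PMF.mem_support_pure_iff] at hj
  rw [hj]

theorem le_answerProb_sampleThen (h : ∀ ω, (T ω).run w = PMF.pure (ans ω, q)) {a : Bool}
    {lam : ℝ} (hlam : freq (fun ω => ans ω ≠ a) ≤ lam) :
    ENNReal.ofReal (1 - lam) ≤ (sampleThen T).answerProb w a := by
  classical
  have hpos : 0 < Fintype.card Ω := Fintype.card_pos
  have hsucc : Fintype.card Ω - 1 + 1 = Fintype.card Ω := Nat.succ_pred_eq_of_pos hpos
  have h1 : 1 - lam ≤ freq fun ω => ans ω = a := by
    have := freq_not fun ω => ans ω = a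
    simp only [ne_eq] at hlam
    linarith
  refine (ENNReal.ofReal_le_ofReal h1).trans (le_of_eq ?_)
  rw [answerProb, sampleThen, run]
  simp only [h, PMF.map_bind, PMF.pure_map, PMF.bind_apply, PMF.uniformOfFintype_apply,
    tsum_fintype, Fintype.card_fin, hsucc]
  have h2 : ∀ f : Ω → ENNReal, ∑ j : Fin (Fintype.card Ω - 1 + 1),
      f ((Fintype.equivFin Ω).symm (Fin.cast hsucc j)) = ∑ ω, f ω := fun f =>
    Fintype.sum_equiv ((finCongr hsucc).trans (Fintype.equivFin Ω).symm) _ _ fun _ => rfl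
  refine Eq.trans ?_ (h2 fun ω => (Fintype.card Ω : ENNReal)⁻¹ * PMF.pure (ans ω) a).symm
  simp only [PMF.pure_apply, ← Finset.mul_sum]
  rw [freq, ENNReal.ofReal_div_of_pos (by exact_mod_cast hpos),
    ENNReal.ofReal_natCast, ENNReal.ofReal_natCast, ENNReal.div_eq_inv_mul]
  congr 1
  rw [Finset.card_filter, Nat.cast_sum]
  refine Finset.sum_congr rfl fun ω _ => ?_
  by_cases h : ans ω = a
  · simp [h]
  · simp [h, Ne.symm h]

end QueryAlg

/-! ### The tester and the weights that it reads -/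

section Tester

variable {ℓ : ℕ} {m : ℕ → ℕ}

/-- The number of nodes that the tester aims at in layer `k`. -/
def targetSize (m : ℕ → ℕ) (s₀ s₁ : ℕ) (k : ℕ) : ℕ := min (if k = 0 then s₀ else s₁) (m k)

/-- In no layer have been drawn more than twice as many nodes as expected. -/
def FewKept (r : ℕ → ℕ) (ω : NodeDraw ℓ m m) : Prop :=
  ∀ k ≤ ℓ + 1, (keptNodes r ω k).card ≤ 2 * r k

/-- The input of a network that is the characteristic vector of a set. -/
abbrev setVec {n : ℕ} (Y : Finset (Fin n)) : Fin n → Bool := fun j => decide (j ∈ Y)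

/-- The sampled part of the network has no output that is larger than `τ` in the direction of
`outSign b`. -/
def NoViolation (b : Fin (m (ℓ + 1)) → Bool) (r : ℕ → ℕ) (τ : ℝ) (ω : NodeDraw ℓ m m)
    (w : WeightIndex ℓ m → ℝ) : Prop :=
  ∀ Y ∈ (keptNodes r ω 0).powerset, ∀ i ∈ keptNodes r ω (ℓ + 1),
    outSign b i * subnetValue (layerMatrix w) (keptNodes r ω) (meanKept m m r)
      (boolVec (setVec Y)) (ℓ + 1) i ≤ τ

/-- The positions of the weights between sampled nodes. -/
def sampledWeights (r : ℕ → ℕ) (ω : NodeDraw ℓ m m) : Finset (WeightIndex ℓ m) :=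
  Finset.univ.filter fun e => e.2.1 ∈ keptNodes r ω (e.1 + 1) ∧ e.2.2 ∈ keptNodes r ω e.1

theorem card_sampledWeights_le {r : ℕ → ℕ} {ω : NodeDraw ℓ m m} (h : FewKept r ω) {s : ℕ}
    (hr : ∀ k, r k ≤ s) : (sampledWeights r ω).card ≤ 4 * (ℓ + 1) * s ^ 2 := by
  have h1 : sampledWeights r ω = Finset.univ.sigma fun k : Fin (ℓ + 1) =>
      keptNodes r ω (k + 1) ×ˢ keptNodes r ω k := by
    ext e
    simp [sampledWeights, Finset.mem_sigma]
  rw [h1, Finset.card_sigma]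
  have h2 : ∀ k ∈ (Finset.univ : Finset (Fin (ℓ + 1))),
      (keptNodes r ω (k + 1) ×ˢ keptNodes r ω k).card ≤ 2 * s * (2 * s) := by
    intro k _
    rw [Finset.card_product]
    exact Nat.mul_le_mul ((h (k + 1) (by omega)).trans (Nat.mul_le_mul_left 2 (hr _)))
      ((h k (by omega)).trans (Nat.mul_le_mul_left 2 (hr _)))
  refine (Finset.sum_le_sum h2).trans (le_of_eq ?_)
  rw [Finset.sum_const, Finset.card_univ, Fintype.card_fin, smul_eq_mul]
  ring

theorem noViolation_congr {b : Fin (m (ℓ + 1)) → Bool} {r : ℕ → ℕ} {τ : ℝ} {ω : NodeDraw ℓ m m}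
    {w w' : WeightIndex ℓ m → ℝ} (h : ∀ e ∈ sampledWeights r ω, w e = w' e) :
    NoViolation b r τ ω w ↔ NoViolation b r τ ω w' := by
  unfold NoViolation
  refine forall₂_congr fun Y _ => forall₂_congr fun i hi => ?_
  rw [subnetValue_congr (W' := layerMatrix w') (ℓ + 1) (fun k hk i hi j hj => ?_) _ le_rfl i hi]
  rw [layerMatrix, layerMatrix, dif_pos hk, dif_pos hk]
  exact h _ (Finset.mem_filter.mpr ⟨Finset.mem_univ _, hi, hj⟩)

open Classical in
/-- The tester: it draws nodes of all layers, queries the weights between them, and rejects if the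
sampled part of the network violates the near constant function with value `b` on some input; it
makes up for missing queries by repeating the query `e₀`. -/
noncomputable def nearConstantTester (hm : ∀ k : Fin (ℓ + 2), 1 ≤ m k)
    (b : Fin (m (ℓ + 1)) → Bool) (r : ℕ → ℕ)
    (τ : ℝ) (Q : ℕ) (e₀ : WeightIndex ℓ m) : QueryAlg (WeightIndex ℓ m) :=
  -- The decision is an implication: an oversized sample is accepted without inspection, after `Q`
  -- dummy queries.
  haveI : Nonempty (NodeDraw ℓ m m) := ⟨fun k _ => ⟨0, hm k⟩⟩
  QueryAlg.sampleThen fun ω : NodeDraw ℓ m m =>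
    QueryAlg.queryList (fun w => decide (FewKept r ω → NoViolation b r τ ω w))
      (if FewKept r ω then (sampledWeights r ω).toList ++
        List.replicate (Q - (sampledWeights r ω).card) e₀ else List.replicate Q e₀) 0

end Tester

/-! ### Error probabilities of the tester -/

section Tester

variable {ℓ : ℕ} {m : ℕ → ℕ}

theorem subnetValue_congr_input {W : (k : ℕ) → Matrix (Fin (m (k + 1))) (Fin (m k)) ℝ}
    {A : (k : ℕ) → Finset (Fin (m k))} {s : ℕ → ℝ} {x x' : Fin (m 0) → ℝ}
    (h : ∀ j ∈ A 0, x j = x' j) (k : ℕ) : ∀ i,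
    subnetValue W A s x (k + 1) i = subnetValue W A s x' (k + 1) i := by
  induction k with
  | zero =>
    intro i
    simp only [subnetValue]
    congr 1
    exact Finset.sum_congr rfl fun j hj => by rw [h j hj]
  | succ k ih =>
    intro i
    rw [subnetValue_succ, subnetValue_succ]
    simp only [ih]

theorem boolVec_setVec_of_mem {n : ℕ} {Y : Finset (Fin n)} {j : Fin n} (h : j ∈ Y) :
    boolVec (setVec Y) j = 1 := by
  simp [boolVec, h]

theorem boolVec_setVec_of_notMem {n : ℕ} {Y : Finset (Fin n)} {j : Fin n} (h : j ∉ Y) :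
    boolVec (setVec Y) j = 0 := by
  simp [boolVec, h]

variable {s₀ s₁ : ℕ}

theorem meanKept_self (hm : ∀ k ≤ ℓ + 1, 1 ≤ m k) (r : ℕ → ℕ) {k : ℕ} (hk : k ≤ ℓ + 1) :
    meanKept m m r k = r k := by
  have : (m k : ℝ) ≠ 0 := by have := hm k hk; positivity
  rw [meanKept]
  field_simp

theorem targetSize_pos (hm : ∀ k ≤ ℓ + 1, 1 ≤ m k) (hs₀ : 1 ≤ s₀) (hs₁ : 1 ≤ s₁) {k : ℕ}
    (hk : k ≤ ℓ + 1) : 1 ≤ targetSize m s₀ s₁ k := by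
  have := hm k hk
  unfold targetSize
  split_ifs <;> omega

theorem targetSize_le (h : s₀ ≤ s₁) (k : ℕ) : targetSize m s₀ s₁ k ≤ s₁ := by
  unfold targetSize
  split_ifs <;> omega

/-- Either the layer exceeds the intended sample size and Chernoff's bound applies, or it is taken
whole and there is no error. -/
theorem keepsAverages_targetSize (hm : ∀ k ≤ ℓ + 1, 1 ≤ m k) (hs₀ : 1 ≤ s₀) (hs₁ : 1 ≤ s₁)
    {γ : ℝ} (hγ0 : 0 ≤ γ) (hγ1 : γ ≤ 1) {k : ℕ} (hk : k ≤ ℓ + 1) {s : ℕ}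
    (hs : s ≤ if k = 0 then s₀ else s₁) :
    KeepsAverages m m (targetSize m s₀ s₁) γ (2 * Real.exp (-(γ ^ 2 * s / 16))) k := by
  rcases Nat.lt_or_ge (if k = 0 then s₀ else s₁) (m k) with h | h
  · have hr : targetSize m s₀ s₁ k = if k = 0 then s₀ else s₁ := min_eq_left h.le
    have h0 := targetSize_pos hm hs₀ hs₁ hk
    refine (keepsAverages_of_lt (hm k hk) h0 (by omega) hγ0 hγ1).mono le_rfl ?_
    rw [meanKept_self hm _ hk, hr]
    gcongr
  · exact keepsAverages_of_eq (hm k hk) (min_eq_right h) hγ0 (by positivity)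

namespace ReLUNetwork

variable (N : ReLUNetwork ℓ m) (b : Fin (m (ℓ + 1)) → Bool)

/-- Dividing the input layer by `c` instead of its size costs at most a factor 2 as `Y` is small;
this explains the bound 2 on the entries in `KeepsAverages`. -/
theorem abs_subnetValue_setVec_le (hm : ∀ k ≤ ℓ + 1, 1 ≤ m k) {c : ℝ} (hc : 0 < c)
    (Y : Finset (Fin (m 0))) (hY : (Y.card : ℝ) ≤ 2 * c) : ∀ k ≤ ℓ, ∀ i,
    |subnetValue (layerMatrix N.weight) (allNodes m) (fun k => if k = 0 then c else m k)
      (boolVec (setVec Y)) (k + 1) i| ≤ 2 := by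
  intro k
  induction k with
  | zero =>
    intro _ i
    have h1 : ∑ j, layerMatrix N.weight 0 i j * max 0 (boolVec (setVec Y) j)
        = ∑ j ∈ Y, layerMatrix N.weight 0 i j := by
      rw [← Finset.sum_filter_add_sum_filter_not Finset.univ (· ∈ Y)]
      rw [Finset.sum_eq_zero (s := Finset.univ.filter (· ∉ Y)), add_zero]
      · rw [Finset.filter_mem_eq_inter, Finset.univ_inter]
        exact Finset.sum_congr rfl fun j hj => by
          rw [boolVec_setVec_of_mem hj, max_eq_right zero_le_one, mul_one]
      · intro j hj
        rw [boolVec_setVec_of_notMem (Finset.mem_filter.mp hj).2, max_self, mul_zero]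
    simp only [subnetValue, if_true]
    rw [h1]
    refine (abs_sum_div_le Y _ (R := 1) hc fun j _ =>
      N.abs_layerMatrix_weight_le 0 i j).trans ?_
    rw [div_le_iff₀ hc]
    linarith
  | succ k ih =>
    intro hk
    exact subnetValue_succ_abs_le N.abs_layerMatrix_weight_le (hm (k + 1) (by omega))
      (by simp) (ih (by omega))

/-- A network that computes the near constant function is rejected with small probability. -/
theorem freq_violation_le (hm : ∀ k ≤ ℓ + 1, 1 ≤ m k) (hs₀ : 1 ≤ s₀) (hs₁ : 1 ≤ s₁)
    (hs : s₀ ≤ s₁) {γ : ℝ} (hγ0 : 0 ≤ γ) (hγ1 : γ ≤ 1)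
    (h : ∀ x, N.compute x = nearConstant b x) :
    freq (fun ω : NodeDraw ℓ m m => FewKept (targetSize m s₀ s₁) ω ∧
      ¬ NoViolation b (targetSize m s₀ s₁) (2 ^ (ℓ + 1) * γ) ω N.weight)
      ≤ ℓ * (2 ^ (2 * s₀) * (2 * s₁) * (2 * Real.exp (-(γ ^ 2 * s₁ / 16)))) := by
  classical
  set r := targetSize m s₀ s₁ with hr
  have hr1 : ∀ k ≤ ℓ + 1, 1 ≤ r k := fun k hk => targetSize_pos hm hs₀ hs₁ hk
  have hmean : ∀ k ≤ ℓ + 1, meanKept m m r k = r k := fun k hk => meanKept_self hm r hk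
  -- The reference network divides input sums by the sample size. Since `Y` lies in the sample,
  -- layer 0 then contributes no error, and only the layers `1, …, ℓ` enter the union bound.
  set n : ℕ → ℝ := fun k => if k = 0 then (r 0 : ℝ) else m k with hn
  let v : Finset (Fin (m 0)) → (k : ℕ) → Fin (m k) → ℝ := fun Y =>
    subnetValue (layerMatrix N.weight) (allNodes m) n (boolVec (setVec Y))
  -- Setting `F` to `∅` for oversized samples makes the cardinality bound valid for every draw.
  let F : (k : ℕ) → NodeDraw ℓ m m → Finset (Finset (Fin (m 0)) × Fin (m (k + 1))) := fun k ω =>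
    if (keptNodes r ω 0).card ≤ 2 * r 0 ∧ (keptNodes r ω (k + 1)).card ≤ 2 * r (k + 1) then
      (keptNodes r ω 0).powerset ×ˢ keptNodes r ω (k + 1) else ∅
  let E : ℕ → NodeDraw ℓ m m → Prop := fun k ω => ∃ t ∈ F k ω, γ <
    |(∑ j ∈ keptNodes r ω k, layerMatrix N.weight k t.2 j * max 0 (v t.1 k j)) / meanKept m m r k
      - (∑ j, layerMatrix N.weight k t.2 j * max 0 (v t.1 k j)) / m k|
  have hE : ∀ k ∈ Finset.Icc 1 ℓ, freq (E k)
      ≤ 2 ^ (2 * s₀) * (2 * s₁) * (2 * Real.exp (-(γ ^ 2 * s₁ / 16))) := by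
    intro k hk
    obtain ⟨hk1, hk2⟩ := Finset.mem_Icc.mp hk
    refine freq_exists_deviation_le (fun k hk => hm k (by omega)) (by positivity)
      (show k < ℓ + 2 by omega)
      (keepsAverages_targetSize hm hs₀ hs₁ hγ0 hγ1 (by omega) (by rw [if_neg (by omega)]))
      (F k) (fun t j => layerMatrix N.weight k t.2 j * max 0 (v t.1 k j)) (fun ω a => ?_)
      (fun ω => ?_) (fun ω t ht j => ?_)
    · simp only [F]
      rw [keptNodes_update_of_ne ω ⟨k, _⟩ a (show 0 ≠ k by omega),
        keptNodes_update_of_ne ω ⟨k, _⟩ a (show k + 1 ≠ k by omega)]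
    · simp only [F]
      split_ifs with hF
      · rw [Finset.card_product, Finset.card_powerset]
        push_cast
        have h1 : r 0 ≤ s₀ := min_le_left _ _
        have h2 : r (k + 1) ≤ s₁ := targetSize_le hs _
        gcongr
        · exact one_le_two
        · exact hF.1.trans (by omega)
        · exact_mod_cast hF.2.trans (by omega)
      · simp only [Finset.card_empty, Nat.cast_zero]
        positivity
    · simp only [F] at ht
      split_ifs at ht with hF
      · obtain ⟨hY, _⟩ := Finset.mem_product.mp ht
        refine abs_mul_max_le (N.abs_layerMatrix_weight_le k _ j) ?_
        obtain ⟨k, rfl⟩ : ∃ k', k = k' + 1 := ⟨k - 1, by omega⟩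
        refine N.abs_subnetValue_setVec_le hm (by exact_mod_cast hr1 0 (by omega)) t.1 ?_ k
          (by omega) j
        have := (Finset.card_le_card (Finset.mem_powerset.mp hY)).trans hF.1
        exact_mod_cast this
      · simp at ht
  refine le_trans (freq_mono fun ω => ?_)
    ((freq_exists_mem_le (Finset.Icc 1 ℓ) E hE).trans (le_of_eq (by simp)))
  rintro ⟨hfew, hviol⟩
  by_contra hcon
  refine hviol fun Y hY i hi => ?_
  have hclose := subnetValue_abs_sub_le (W := layerMatrix N.weight) (A := keptNodes r ω)
    (s := meanKept m m r) (n := n) (x := boolVec (setVec Y)) (γ := γ) (ℓ + 1)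
    (fun k i' => i' ∈ keptNodes r ω k) (fun _ _ _ hj => hj)
    (fun k hk => by rw [hmean k (by omega)]; exact_mod_cast hr1 k (by omega))
    N.abs_layerMatrix_weight_le
    (fun k hk => by rw [hmean k (by omega)]; exact_mod_cast hfew k (by omega))
    (fun k hk i' hi' => by
      rcases Nat.eq_zero_or_pos k with rfl | hk0
      · have h1 : ∑ j ∈ keptNodes r ω 0, layerMatrix N.weight 0 i' j *
              max 0 (boolVec (setVec Y) j)
            = ∑ j, layerMatrix N.weight 0 i' j * max 0 (boolVec (setVec Y) j) := by
          refine Finset.sum_subset (Finset.subset_univ _) fun j _ hj => ?_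
          have : j ∉ Y := fun hjY => hj (Finset.mem_powerset.mp hY hjY)
          rw [boolVec_setVec_of_notMem this, max_self, mul_zero]
        simp only [subnetValue]
        rw [h1, hmean 0 (by omega), hn]
        simpa using hγ0
      · by_contra hlt
        refine hcon ⟨k, Finset.mem_Icc.mpr ⟨hk0, by omega⟩, (Y, i'), ?_, ?_⟩
        · simp only [F]
          rw [if_pos ⟨hfew 0 (by omega), hfew (k + 1) (by omega)⟩]
          exact Finset.mem_product.mpr ⟨hY, hi'⟩
        · have hnk : n k = m k := if_neg (by omega)
          rw [hnk] at hlt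
          exact not_le.mp hlt)
    (ℓ + 1) le_rfl i hi
  have hnpos : ∀ k < ℓ + 1, 0 < n k := by
    intro k hk
    simp only [hn]
    split_ifs
    · exact_mod_cast hr1 0 (by omega)
    · exact_mod_cast hm k (by omega)
  have h1 := N.outSign_mul_value_nonpos b h (setVec Y) i
  rw [N.value_eq_subnetValue, subnetValue_eq_mul_prod hnpos _ le_rfl, mul_left_comm] at h1
  have hprod : 0 < ∏ t ∈ Finset.range (ℓ + 1), n t :=
    Finset.prod_pos fun t ht => hnpos t (Finset.mem_range.mp ht)
  -- The sign survives normalisation, so the sampled value exceeds 0 by at most the sampling error.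
  have h2 := nonpos_of_mul_nonpos_right h1 hprod
  have h3 : outSign b i * (subnetValue (layerMatrix N.weight) (keptNodes r ω) (meanKept m m r)
      (boolVec (setVec Y)) (ℓ + 1) i - subnetValue (layerMatrix N.weight) (allNodes m) n
      (boolVec (setVec Y)) (ℓ + 1) i) ≤ (2 ^ (ℓ + 1) - 1) * γ := by
    refine (le_abs_self _).trans ?_
    rw [abs_mul, abs_outSign, one_mul]
    exact hclose
  linarith

/-- A network with many outputs that are somewhere far on the wrong side is accepted with small
probability. -/
theorem freq_noViolation_le (hm : ∀ k ≤ ℓ + 1, 1 ≤ m k) (hs₀ : 1 ≤ s₀) (hs : s₀ ≤ s₁)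
    {γ : ℝ} (hγ0 : 0 < γ) (hγ1 : γ ≤ 1) (B : Finset (Fin (m (ℓ + 1))))
    (hB : γ * m (ℓ + 1) < B.card)
    (hBx : ∀ i ∈ B, ∃ x, 2 ^ (ℓ + 2) * γ < outSign b i * N.normValue x (ℓ + 1) i) :
    freq (fun ω : NodeDraw ℓ m m => ¬ (FewKept (targetSize m s₀ s₁) ω ∧
      ¬ NoViolation b (targetSize m s₀ s₁) (2 ^ (ℓ + 1) * γ) ω N.weight))
      ≤ (ℓ + 3 + 4 * (ℓ + 1) * s₁ ^ 2) * (2 * Real.exp (-(γ ^ 2 * s₀ / 16))) := by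
  classical
  set r := targetSize m s₀ s₁ with hr
  set η : ℝ := 2 * Real.exp (-(γ ^ 2 * s₀ / 16)) with hη
  have hη0 : 0 ≤ η := by positivity
  have hr1 : ∀ k ≤ ℓ + 1, 1 ≤ r k := fun k hk => targetSize_pos hm hs₀ (hs₀.trans hs) hk
  have hmean : ∀ k ≤ ℓ + 1, meanKept m m r k = r k := fun k hk => meanKept_self hm r hk
  have hmlt : ∀ k < ℓ + 2, 0 < m k := fun k hk => hm k (by omega)
  have hav : ∀ k ≤ ℓ + 1, KeepsAverages m m r γ η k := fun k hk =>
    keepsAverages_targetSize hm hs₀ (hs₀.trans hs) hγ0.le hγ1 hk (by split_ifs <;> omega)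
  -- The witness input depends on the bad output only, so pairs of an output and a node suffice in
  -- the union bound.
  choose! x hx using hBx
  let F : (k : ℕ) → NodeDraw ℓ m m → Finset (Fin (m (ℓ + 1)) × Fin (m (k + 1))) := fun k ω =>
    if (keptNodes r ω (ℓ + 1)).card ≤ 2 * r (ℓ + 1) ∧
        (keptNodes r ω (k + 1)).card ≤ 2 * r (k + 1) then
      keptNodes r ω (ℓ + 1) ×ˢ keptNodes r ω (k + 1) else ∅
  let E : ℕ → NodeDraw ℓ m m → Prop := fun k ω => ∃ t ∈ F k ω, γ <
    |(∑ j ∈ keptNodes r ω k, layerMatrix N.weight k t.2 j * max 0 (N.normValue (x t.1) k j))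
        / meanKept m m r k
      - (∑ j, layerMatrix N.weight k t.2 j * max 0 (N.normValue (x t.1) k j)) / m k|
  have hE : ∀ k ∈ Finset.range (ℓ + 1), freq (E k) ≤ 4 * s₁ ^ 2 * η := by
    intro k hk
    have hk := Finset.mem_range.mp hk
    refine freq_exists_deviation_le hmlt hη0 (by omega) (hav k (by omega)) (F k)
      (fun t j => layerMatrix N.weight k t.2 j * max 0 (N.normValue (x t.1) k j)) (fun ω a => ?_)
      (fun ω => ?_) (fun ω t _ j => ?_)
    · simp only [F]
      rw [keptNodes_update_of_ne ω ⟨k, _⟩ a (show ℓ + 1 ≠ k by omega),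
        keptNodes_update_of_ne ω ⟨k, _⟩ a (show k + 1 ≠ k by omega)]
    · simp only [F]
      split_ifs with hF
      · rw [Finset.card_product]
        have h1 : r (ℓ + 1) ≤ s₁ := targetSize_le hs _
        have h2 : r (k + 1) ≤ s₁ := targetSize_le hs _
        have h3 := Nat.mul_le_mul (hF.1.trans (Nat.mul_le_mul_left 2 h1))
          (hF.2.trans (Nat.mul_le_mul_left 2 h2))
        calc _ ≤ ((2 * s₁ * (2 * s₁) : ℕ) : ℝ) := by exact_mod_cast h3
          _ = _ := by push_cast; ring
      · simp only [Finset.card_empty, Nat.cast_zero]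
        positivity
    · exact (abs_mul_max_le (N.abs_layerMatrix_weight_le k _ j)
        (N.abs_normValue_le (fun k hk => hm k (by omega)) _ k (by omega) j)).trans one_le_two
  have hEall := freq_exists_mem_le (Finset.range (ℓ + 1)) E hE
  have hsize := freq_exists_mem_le (Finset.range (ℓ + 2)) (fun k (ω : NodeDraw ℓ m m) =>
      γ < |((keptNodes r ω k).card : ℝ) / meanKept m m r k - 1|) (η := η) (fun k hk => by
    have hk := Finset.mem_range.mp hk
    exact freq_card_keptNodes_le hmlt hη0 hk (hmlt k hk) (hav k (by omega)))
  -- Applied to the indicator of `B`: a sample that misses `B` deviates by the density of `B`, which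
  -- exceeds `γ`.
  have hhit := freq_exists_deviation_le hmlt hη0 (show ℓ + 1 < ℓ + 2 by omega)
    (hav (ℓ + 1) le_rfl) (fun _ => ({()} : Finset Unit))
    (fun _ i => if i ∈ B then (1 : ℝ) else 0) (M := 1) (fun _ _ => rfl) (by simp)
    (fun _ _ _ j => by split_ifs <;> simp)
  rw [Finset.card_range] at hEall hsize
  refine (freq_mono (q := fun ω => _ ∨ (_ ∨ _)) fun ω hω => ?_).trans ((freq_or_le _ _).trans
    ((add_le_add hsize ((freq_or_le _ _).trans (add_le_add hhit hEall))).trans (le_of_eq ?_)))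
  · by_contra hcon
    obtain ⟨h1, h2⟩ := not_or.mp hcon
    obtain ⟨h2, h3⟩ := not_or.mp h2
    have hfew : FewKept r ω := by
      intro k hk
      by_contra hlt
      refine h1 ⟨k, Finset.mem_range.mpr (by omega), ?_⟩
      have h4 : (0 : ℝ) < r k := by exact_mod_cast hr1 k hk
      have h5 : (2 : ℝ) * r k < (keptNodes r ω k).card := by exact_mod_cast not_le.mp hlt
      rw [← lt_div_iff₀ h4] at h5
      rw [hmean k hk]
      refine lt_of_lt_of_le ?_ (le_abs_self _)
      linarith
    obtain ⟨i, hiA, hiB⟩ : ∃ i ∈ keptNodes r ω (ℓ + 1), i ∈ B := by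
      by_contra! hno
      refine h2 ⟨(), by simp, ?_⟩
      have hm0 : (0 : ℝ) < m (ℓ + 1) := by exact_mod_cast hm (ℓ + 1) le_rfl
      rw [Finset.sum_eq_zero fun j hj => if_neg (hno j hj), zero_div, zero_sub, abs_neg]
      refine lt_of_lt_of_le ?_ (le_abs_self _)
      rw [lt_div_iff₀ hm0]
      simpa using hB
    refine hω ⟨hfew, fun hno => ?_⟩
    have hclose := subnetValue_abs_sub_le (W := layerMatrix N.weight) (A := keptNodes r ω)
      (s := meanKept m m r) (n := fun k => (m k : ℝ)) (x := boolVec (x i)) (γ := γ) (ℓ + 1)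
      (fun k i' => i' ∈ keptNodes r ω k) (fun _ _ _ hj => hj)
      (fun k hk => by rw [hmean k (by omega)]; exact_mod_cast hr1 k (by omega))
      N.abs_layerMatrix_weight_le
      (fun k hk => by rw [hmean k (by omega)]; exact_mod_cast hfew k (by omega))
      (fun k hk i' hi' => by
        by_contra hlt
        refine h3 ⟨k, Finset.mem_range.mpr hk, (i, i'), ?_, not_le.mp hlt⟩
        simp only [F]
        rw [if_pos ⟨hfew (ℓ + 1) le_rfl, hfew (k + 1) (by omega)⟩]
        exact Finset.mem_product.mpr ⟨hiA, hi'⟩)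
      (ℓ + 1) le_rfl i hiA
    -- The subnetwork sees only sampled inputs, so the trace of the witness on them gives the same
    -- value.
    have h4 := hno ((keptNodes r ω 0).filter fun j => x i j = true)
      (Finset.mem_powerset.mpr (Finset.filter_subset _ _)) i hiA
    rw [subnetValue_congr_input (x' := boolVec (x i)) (fun j hj => by simp [boolVec, hj])] at h4
    have h5 : outSign b i * (N.normValue (x i) (ℓ + 1) i - subnetValue (layerMatrix N.weight)
        (keptNodes r ω) (meanKept m m r) (boolVec (x i)) (ℓ + 1) i) ≤ (2 ^ (ℓ + 1) - 1) * γ := by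
      refine (le_abs_self _).trans ?_
      rw [abs_mul, abs_outSign, one_mul, abs_sub_comm]
      exact hclose
    have h6 := hx i hiB
    have h7 : (2 : ℝ) ^ (ℓ + 2) = 2 * 2 ^ (ℓ + 1) := by ring
    rw [h7] at h6
    linarith
  · push_cast
    ring

end ReLUNetwork

end Tester

/-! ### Choice of the sample sizes -/

section Parameters

theorem exists_pow_dominates (A B : ℝ) (hA : 0 < A) (n : ℕ) :
    ∃ K : ℕ, n ≤ K ∧ A * (K : ℝ) ^ 4 * 4 ^ n ≤ 4 ^ K ∧ B ≤ K := by
  have h := tendsto_pow_const_div_const_pow_of_one_lt 4 (by norm_num : (1 : ℝ) < 4)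
  have h1 := h.eventually (Iio_mem_nhds (by positivity : (0 : ℝ) < 1 / (A * 4 ^ n)))
  obtain ⟨K, hK, hn, hB⟩ := (h1.and ((Filter.eventually_ge_atTop n).and
    (Filter.eventually_ge_atTop ⌈B⌉₊))).exists
  refine ⟨K, hn, ?_, Nat.ceil_le.mp hB⟩
  rw [div_lt_div_iff₀ (by positivity) (by positivity)] at hK
  linarith

theorem ceil_le_two_mul {y : ℝ} (hy : 1 ≤ y) : (⌈y⌉₊ : ℝ) ≤ 2 * y := by
  have := Nat.ceil_lt_add_one (by linarith : 0 ≤ y)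
  linarith

theorem one_le_log_inv_mul {ε lam : ℝ} (hε : 0 < ε) (hε2 : ε < 1 / 2) (hl : 0 < lam)
    (hl2 : lam < 1 / 2) : 4 ≤ 1 / (lam * ε) ∧ 1 ≤ Real.log (1 / (lam * ε)) := by
  have h1 : 4 ≤ 1 / (lam * ε) := by
    rw [le_div_iff₀ (by positivity)]
    nlinarith
  refine ⟨h1, ?_⟩
  rw [Real.le_log_iff_exp_le (by linarith)]
  have := Real.exp_one_lt_d9
  linarith

set_option maxHeartbeats 1000000 in
/-- Sizes of the samples of nodes that make the error probabilities small and need few queries. -/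
theorem exists_sampleSizes (ℓ : ℕ) (hℓ : 1 ≤ ℓ) {κ : ℝ} (hκ : 1 ≤ κ) :
    ∃ C : ℝ, 0 < C ∧ ∀ ε lam : ℝ, 0 < ε → ε < 1 / 2 → 0 < lam → lam < 1 / 2 →
      ∃ s₀ s₁ : ℕ, 1 ≤ s₀ ∧ s₀ ≤ s₁ ∧
        (ℓ + 3 + 4 * (ℓ + 1) * (s₁ : ℝ) ^ 2) *
          (2 * Real.exp (-((ε ^ ℓ / κ) ^ 2 * s₀ / 16))) ≤ lam ∧
        ℓ * (2 ^ (2 * s₀) * (2 * (s₁ : ℝ)) *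
          (2 * Real.exp (-((ε ^ ℓ / κ) ^ 2 * s₁ / 16)))) ≤ lam ∧
        4 * (ℓ + 1) * (s₁ : ℝ) ^ 2
          ≤ C * ((1 / ε) ^ (8 * ℓ ^ 2 + 1) * Real.log (1 / (lam * ε)) ^ 4) := by
  set G : ℝ := 16 * κ ^ 2 with hG
  have hG1 : 1 ≤ G := by nlinarith
  have hℓ0 : (1 : ℝ) ≤ ℓ := by exact_mod_cast hℓ
  -- `K` is fixed before `ε` and `lam`: domination at base 4 transfers to base `X` because `4 ≤ X`.
  -- The exponent `8 * ℓ + 3` covers `s₁ ^ 2`, of order at most `X ^ (8 * ℓ + 2)`, and one more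
  -- factor to get below `1 / X`.
  obtain ⟨K, hK1, hK2, hK3⟩ := exists_pow_dominates (14 * (ℓ + 1) * (16 * G ^ 4)) 3
    (by positivity) (8 * ℓ + 3)
  have hK0 : (0 : ℝ) < K := by linarith
  refine ⟨64 * (ℓ + 1) * K ^ 4 * G ^ 4, by positivity, fun ε lam hε hε2 hl hl2 => ?_⟩
  obtain ⟨hX, hΛ⟩ := one_le_log_inv_mul hε hε2 hl hl2
  set X : ℝ := 1 / (lam * ε) with hXdef
  set Λ : ℝ := Real.log X with hΛdef
  have hX0 : 0 < X := by linarith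
  have hΛX : Λ ≤ X := (Real.log_le_sub_one_of_pos hX0).trans (by linarith)
  have hε1 : 1 ≤ 1 / ε := by rw [le_div_iff₀ hε]; linarith
  have hεX : 1 / ε ≤ X := by
    rw [hXdef]
    gcongr
    nlinarith
  have hlX : 1 / X ≤ lam := by
    rw [hXdef, one_div_one_div]
    nlinarith
  set g : ℝ := (ε ^ ℓ / κ) ^ 2 / 16 with hg
  have hg0 : 0 < g := by positivity
  have hginv : 1 / g = G * (1 / ε) ^ (2 * ℓ) := by
    rw [hg, hG, one_div_pow, pow_mul', div_pow]
    field_simp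
  have hginv1 : 1 ≤ 1 / g := by
    rw [hginv]
    exact one_le_mul_of_one_le_of_one_le hG1 (one_le_pow₀ hε1)
  have hg1 : g ≤ 1 := by rwa [le_div_iff₀ hg0, one_mul] at hginv1
  -- This makes the soundness exponential at most `X ^ (-K)`. In turn `g * s₁ ≥ K * s₀` with `3 ≤ K`
  -- and `g ≤ 1` absorbs `2 ^ (2 * s₀)` and leaves `exp (-(g * s₀))`, reducing the second bound to
  -- the first.
  set s₀ : ℕ := ⌈K * Λ * (1 / g)⌉₊ with hs₀
  set s₁ : ℕ := ⌈K * s₀ * (1 / g)⌉₊ with hs₁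
  have hKΛ : 1 ≤ K * Λ := one_le_mul_of_one_le_of_one_le (by linarith) hΛ
  have h0a : K * Λ * (1 / g) ≤ s₀ := Nat.le_ceil _
  have h01 : (1 : ℝ) ≤ s₀ :=
    (one_le_mul_of_one_le_of_one_le hKΛ hginv1).trans h0a
  have h0b : (s₀ : ℝ) ≤ 2 * (K * Λ * (1 / g)) :=
    ceil_le_two_mul (one_le_mul_of_one_le_of_one_le hKΛ hginv1)
  have hKs : 1 ≤ K * (s₀ : ℝ) := one_le_mul_of_one_le_of_one_le (by linarith) h01
  have h1a : K * s₀ * (1 / g) ≤ s₁ := Nat.le_ceil _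
  have h1b : (s₁ : ℝ) ≤ 2 * (K * s₀ * (1 / g)) :=
    ceil_le_two_mul (one_le_mul_of_one_le_of_one_le hKs hginv1)
  have h0le1 : (s₀ : ℝ) ≤ s₁ := by
    refine le_trans ?_ h1a
    have h1 : (s₀ : ℝ) ≤ K * s₀ := le_mul_of_one_le_left (by linarith) (by linarith)
    exact h1.trans (le_mul_of_one_le_right (by linarith) hginv1)
  have h11 : (1 : ℝ) ≤ s₁ := h01.trans h0le1
  have hs1sq : (s₁ : ℝ) ^ 2 ≤ 16 * K ^ 4 * G ^ 4 * (Λ ^ 2 * (1 / ε) ^ (8 * ℓ)) := by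
    have h1 : (s₁ : ℝ) ≤ 4 * K ^ 2 * Λ * (1 / g) ^ 2 := by
      refine h1b.trans ?_
      have := mul_le_mul_of_nonneg_left h0b (by positivity : 0 ≤ 2 * (K : ℝ) * (1 / g))
      calc 2 * (K * s₀ * (1 / g)) = 2 * K * (1 / g) * s₀ := by ring
        _ ≤ _ := this
        _ = _ := by ring
    calc (s₁ : ℝ) ^ 2 ≤ (4 * K ^ 2 * Λ * (1 / g) ^ 2) ^ 2 := by gcongr
      _ = 16 * K ^ 4 * G ^ 4 * (Λ ^ 2 * (1 / ε) ^ (8 * ℓ)) := by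
        rw [hginv]
        ring
  have hexp0 : Real.exp (-(g * s₀)) ≤ 1 / X ^ K := by
    have h1 : K * Λ ≤ g * s₀ := by
      have := mul_le_mul_of_nonneg_left h0a hg0.le
      rwa [mul_one_div, mul_div_cancel₀ _ hg0.ne'] at this
    calc Real.exp (-(g * s₀)) ≤ Real.exp (-(K * Λ)) := Real.exp_le_exp.mpr (by linarith)
      _ = 1 / X ^ K := by
        rw [Real.exp_neg, Real.exp_nat_mul, hΛdef, Real.exp_log hX0, one_div]
  have hA : (ℓ + 3 + 4 * (ℓ + 1) * (s₁ : ℝ) ^ 2) * (2 * Real.exp (-(g * s₀))) ≤ lam := by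
    have h1 : 1 ≤ (s₁ : ℝ) ^ 2 := one_le_pow₀ h11
    have h2 : (ℓ + 3 + 4 * (ℓ + 1) * (s₁ : ℝ) ^ 2) * 2 ≤ 14 * (ℓ + 1) * (s₁ : ℝ) ^ 2 := by
      nlinarith
    have h3 : (s₁ : ℝ) ^ 2 ≤ 16 * K ^ 4 * G ^ 4 * X ^ (8 * ℓ + 2) := by
      refine hs1sq.trans ?_
      have h4 : Λ ^ 2 * (1 / ε) ^ (8 * ℓ) ≤ X ^ 2 * X ^ (8 * ℓ) := by
        gcongr
      rw [← pow_add, add_comm 2] at h4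
      gcongr
    have h5 : 14 * (ℓ + 1) * (16 * K ^ 4 * G ^ 4 * X ^ (8 * ℓ + 2)) * X ≤ X ^ K := by
      have h6 : (4 : ℝ) ^ (K - (8 * ℓ + 3)) ≤ X ^ (K - (8 * ℓ + 3)) := by gcongr
      have h7 : 14 * (ℓ + 1) * (16 * G ^ 4) * (K : ℝ) ^ 4 ≤ 4 ^ (K - (8 * ℓ + 3)) := by
        rw [← pow_sub_mul_pow (4 : ℝ) hK1] at hK2
        exact le_of_mul_le_mul_right hK2 (by positivity)
      rw [← pow_sub_mul_pow X hK1]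
      calc 14 * (ℓ + 1) * (16 * K ^ 4 * G ^ 4 * X ^ (8 * ℓ + 2)) * X
          = 14 * (ℓ + 1) * (16 * G ^ 4) * (K : ℝ) ^ 4 * X ^ (8 * ℓ + 3) := by ring
        _ ≤ _ := mul_le_mul_of_nonneg_right (h7.trans h6) (by positivity)
    calc (ℓ + 3 + 4 * (ℓ + 1) * (s₁ : ℝ) ^ 2) * (2 * Real.exp (-(g * s₀)))
        = (ℓ + 3 + 4 * (ℓ + 1) * (s₁ : ℝ) ^ 2) * 2 * Real.exp (-(g * s₀)) := by ring
      _ ≤ 14 * (ℓ + 1) * (16 * K ^ 4 * G ^ 4 * X ^ (8 * ℓ + 2)) * (1 / X ^ K) := by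
        refine mul_le_mul (h2.trans ?_) hexp0 (Real.exp_pos _).le (by positivity)
        gcongr
      _ ≤ 1 / X := by
        rw [mul_one_div, div_le_div_iff₀ (by positivity) hX0, one_mul]
        exact h5
      _ ≤ lam := hlX
  have hgs : ∀ s : ℕ, (ε ^ ℓ / κ) ^ 2 * s / 16 = g * s := fun s => by rw [hg]; ring
  refine ⟨s₀, s₁, by exact_mod_cast h01, by exact_mod_cast h0le1, by rwa [hgs], ?_, ?_⟩
  · rw [hgs]
    refine le_trans ?_ hA
    have h1 : K * (s₀ : ℝ) ≤ g * s₁ := by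
      have := mul_le_mul_of_nonneg_left h1a hg0.le
      rwa [mul_one_div, mul_div_cancel₀ _ hg0.ne'] at this
    have h2 : (2 : ℝ) ^ (2 * s₀) ≤ Real.exp (2 * s₀) := by
      have h3 : (2 : ℝ) ≤ Real.exp 1 := by
        have := Real.add_one_le_exp (1 : ℝ)
        linarith
      calc (2 : ℝ) ^ (2 * s₀) ≤ Real.exp 1 ^ (2 * s₀) := by gcongr
        _ = Real.exp (2 * s₀) := by
          rw [← Real.exp_nat_mul]
          push_cast
          rw [mul_one]
    have h4 : (2 : ℝ) ^ (2 * s₀) * Real.exp (-(g * s₁)) ≤ Real.exp (-(g * s₀)) := by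
      refine (mul_le_mul_of_nonneg_right h2 (Real.exp_pos _).le).trans ?_
      rw [← Real.exp_add]
      refine Real.exp_le_exp.mpr ?_
      nlinarith
    have h5 : (ℓ : ℝ) * (2 * s₁) ≤ ℓ + 3 + 4 * (ℓ + 1) * (s₁ : ℝ) ^ 2 := by
      have h6 : (s₁ : ℝ) ≤ (s₁ : ℝ) ^ 2 := le_self_pow₀ h11 (by norm_num)
      have h7 := mul_le_mul_of_nonneg_left h6 (by linarith : 0 ≤ (ℓ : ℝ))
      have h8 : 0 ≤ (ℓ : ℝ) * (s₁ : ℝ) ^ 2 := by positivity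
      linarith [sq_nonneg (s₁ : ℝ)]
    calc (ℓ : ℝ) * (2 ^ (2 * s₀) * (2 * (s₁ : ℝ)) * (2 * Real.exp (-(g * s₁))))
        = ℓ * (2 * s₁) * (2 * (2 ^ (2 * s₀) * Real.exp (-(g * s₁)))) := by ring
      _ ≤ _ := by gcongr
  -- The sample needs only order `Λ ^ 2 * (1 / ε) ^ (8 * ℓ)` queries, within the budget.
  · have h1 : (1 / ε) ^ (8 * ℓ) ≤ (1 / ε) ^ (8 * ℓ ^ 2 + 1) :=
      pow_le_pow_right₀ hε1 (by nlinarith)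
    have h2 : Λ ^ 2 ≤ Λ ^ 4 := pow_le_pow_right₀ hΛ (by norm_num)
    calc 4 * (ℓ + 1) * (s₁ : ℝ) ^ 2
        ≤ 4 * (ℓ + 1) * (16 * K ^ 4 * G ^ 4 * (Λ ^ 2 * (1 / ε) ^ (8 * ℓ))) := by gcongr
      _ ≤ 4 * (ℓ + 1) * (16 * K ^ 4 * G ^ 4 * (Λ ^ 4 * (1 / ε) ^ (8 * ℓ ^ 2 + 1))) := by gcongr
      _ = _ := by ring

end Parameters

/-! ### Runs of the tester and the main theorem -/

section TesterRuns

variable {ℓ : ℕ} {m : ℕ → ℕ}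

open Classical in
theorem run_testerBranch (b : Fin (m (ℓ + 1)) → Bool) {r : ℕ → ℕ} (τ : ℝ) {Q s : ℕ}
    (e₀ : WeightIndex ℓ m) (hr : ∀ k, r k ≤ s) (hQ : 4 * (ℓ + 1) * s ^ 2 ≤ Q)
    (w : WeightIndex ℓ m → ℝ) (ω : NodeDraw ℓ m m) :
    (QueryAlg.queryList (fun w => decide (FewKept r ω → NoViolation b r τ ω w))
      (if FewKept r ω then (sampledWeights r ω).toList ++
        List.replicate (Q - (sampledWeights r ω).card) e₀ else List.replicate Q e₀) 0).run w
      = PMF.pure (decide (FewKept r ω → NoViolation b r τ ω w), Q) := by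
  rw [QueryAlg.run_queryList]
  refine congrArg PMF.pure (Prod.ext (decide_eq_decide.mpr ?_) ?_)
  · refine forall_congr' fun hfew => noViolation_congr fun e he => ?_
    rw [if_pos hfew, if_pos (List.mem_append_left _ (Finset.mem_toList.mpr he))]
  · split_ifs with hfew
    · have := card_sampledWeights_le hfew hr
      simp only [List.length_append, Finset.length_toList, List.length_replicate]
      omega
    · simp

end TesterRuns

theorem mainTheorem8 (ℓ : ℕ) (hℓ : 1 ≤ ℓ) :
    ∃ c c₁ c₂ : ℝ, 0 < c ∧ 0 < c₁ ∧ 0 < c₂ ∧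
      ∀ (m : ℕ → ℕ) (ε δ lam lamStar : ℝ) (b : Fin (m (ℓ + 1)) → Bool),
        (∀ k ≤ ℓ, 1 ≤ m k) →
        2 ≤ m (ℓ + 1) →
        0 < lam → lam < 1 / ((ℓ : ℝ) + 1) →
        0 < lamStar → lamStar < 1 / ((ℓ : ℝ) + 1) →
        2 * (17 * ((ℓ : ℝ) + 1) / (((Finset.range (ℓ + 1)).sup m : ℕ) : ℝ)) ^ (1 / (ℓ : ℝ)) < ε →
        ε < 1 / 2 →
        2 * (m (ℓ + 1) : ℝ) * (lamStar + Real.exp (-(m 0 : ℝ) / 16)) ≤ δ →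
        (∀ k ≤ ℓ, c * (2 / ε) ^ (2 * ℓ ^ 2) *
          Real.log (1 / lamStar * ∏ i ∈ Finset.Icc 1 ℓ, (m i : ℝ)) ≤ (m k : ℝ)) →
        ∃ T : QueryAlg (WeightIndex ℓ m),
          ∀ N : ReLUNetwork ℓ m,
            (∀ p ∈ (T.run N.weight).support,
              c₁ * ((1 / ε) ^ (8 * ℓ ^ 2 + 1) * Real.log (1 / (lam * ε)) ^ 4) ≤ (p.2 : ℝ) ∧
              (p.2 : ℝ) ≤ c₂ * ((1 / ε) ^ (8 * ℓ ^ 2 + 1) * Real.log (1 / (lam * ε)) ^ 4)) ∧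
            ((∀ x, N.compute x = nearConstant b x) →
              ENNReal.ofReal (1 - lam) ≤ T.answerProb N.weight true) ∧
            (N.IsFar ε δ (nearConstant b) →
              ENNReal.ofReal (1 - lam) ≤ T.answerProb N.weight false) := by
  classical
  -- Chosen so that `2 ^ (ℓ + 3) * γ = (ε / 10) ^ ℓ / 8`, half of what the chain overcomes.
  set κ : ℝ := 64 * 20 ^ ℓ with hκ
  have h20 : (20 : ℝ) ≤ 20 ^ ℓ := le_self_pow₀ (by norm_num) (by omega)
  have hκ1 : 1280 ≤ κ := by linarith
  obtain ⟨C, hC, hsizes⟩ := exists_sampleSizes ℓ hℓ (by linarith : 1 ≤ κ)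
  refine ⟨96 * κ ^ 2, C, C + 1, by positivity, hC, by positivity, ?_⟩
  intro m ε δ lam lamStar b hm hmout hl0 hl1 hs0 hs1 hroot hε2 hδ hlarge
  have hε : 0 < ε := lt_of_le_of_lt (by positivity) hroot
  have hℓ0 : (1 : ℝ) ≤ ℓ := by exact_mod_cast hℓ
  have hl2 : lam < 1 / 2 := by
    refine hl1.trans_le ?_
    gcongr
    linarith
  have hm' : ∀ k ≤ ℓ + 1, 1 ≤ m k := by
    intro k hk
    rcases Nat.lt_or_ge ℓ k with h | h
    · obtain rfl : k = ℓ + 1 := by omega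
      omega
    · exact hm k h
  obtain ⟨s₀, s₁, hs₀, hs₀₁, hsound, hcompl, hqueries⟩ := hsizes ε lam hε hε2 hl0 hl2
  set γ : ℝ := ε ^ ℓ / κ with hγ
  have hγ0 : 0 < γ := by positivity
  have hγε : γ ≤ ε / 1280 := by
    have h1 : ε ^ ℓ ≤ ε := pow_le_of_le_one hε.le (by linarith) (by omega)
    rw [hγ]
    gcongr
  have hγ2 : 2 ^ (ℓ + 3) * γ < (ε / 10) ^ ℓ / 4 := by
    have h1 : (20 : ℝ) ^ ℓ = 2 ^ ℓ * 10 ^ ℓ := by rw [← mul_pow]; norm_num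
    have h2 : 2 ^ (ℓ + 3) * γ = (ε / 10) ^ ℓ / 8 := by
      rw [hγ, hκ, h1, div_pow, pow_add]
      field_simp
      norm_num
    have h3 : 0 < (ε / 10) ^ ℓ := by positivity
    linarith
  set Y : ℝ := (1 / ε) ^ (8 * ℓ ^ 2 + 1) * Real.log (1 / (lam * ε)) ^ 4 with hY
  have hε1 : 1 ≤ 1 / ε := by rw [le_div_iff₀ hε]; linarith
  have hY1 : 1 ≤ Y := one_le_mul_of_one_le_of_one_le (one_le_pow₀ hε1)
    (one_le_pow₀ (one_le_log_inv_mul hε hε2 hl0 hl2).2)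
  -- Every run makes exactly `Q` queries, which gives both bounds; rounding up is absorbed by `C +
  -- 1` because `1 ≤ Y`.
  set Q : ℕ := ⌈C * Y⌉₊ with hQ
  have hQ1 : C * Y ≤ Q := Nat.le_ceil _
  have hQ2 : (Q : ℝ) ≤ (C + 1) * Y := by
    have := Nat.ceil_lt_add_one (by positivity : 0 ≤ C * Y)
    linarith
  have hQ3 : 4 * (ℓ + 1) * s₁ ^ 2 ≤ Q := by exact_mod_cast hqueries.trans hQ1
  let e₀ : WeightIndex ℓ m := ⟨0, ⟨0, hm' _ (by simp)⟩, ⟨0, hm' 0 (by omega)⟩⟩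
  have : Nonempty (NodeDraw ℓ m m) := ⟨fun k _ => ⟨0, hm' k (by omega)⟩⟩
  refine ⟨nearConstantTester (fun k => hm' k (by omega)) b (targetSize m s₀ s₁)
    (2 ^ (ℓ + 1) * γ) Q e₀, fun N => ?_⟩
  have hrun := run_testerBranch b (2 ^ (ℓ + 1) * γ) e₀ (targetSize_le (m := m) hs₀₁) hQ3 N.weight
  refine ⟨fun p hp => ?_, fun hN => ?_, fun hN => ?_⟩
  · rw [QueryAlg.snd_eq_of_mem_support_run_sampleThen hrun hp]
    exact ⟨hQ1, hQ2⟩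
  · refine QueryAlg.le_answerProb_sampleThen hrun ((freq_mono fun ω hω => ?_).trans
      ((N.freq_violation_le b hm' hs₀ (hs₀.trans hs₀₁) hs₀₁ hγ0.le (by linarith) hN).trans hcompl))
    simpa using hω
  · let B : Finset (Fin (m (ℓ + 1))) := Finset.univ.filter fun i =>
      ∃ x, 2 ^ (ℓ + 2) * γ < outSign b i * N.normValue x (ℓ + 1) i
    -- With fewer bad outputs the network could be repaired, contradicting farness.
    have hB : ε / 2 * m (ℓ + 1) < B.card := by
      by_contra! hB
      refine hN (N.isClose_of_normValue_le b hℓ hm (hm' _ le_rfl) hε hε2 hs0 hs1 hδ hγ0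
        (by linarith) hγ2 (fun k hk => ?_) B hB fun i hi x => ?_)
      · have hlog : 0 ≤ Real.log (1 / lamStar * ∏ i ∈ Finset.Icc 1 ℓ, (m i : ℝ)) := by
          refine Real.log_nonneg (one_le_mul_of_one_le_of_one_le ?_ ?_)
          · rw [le_div_iff₀ hs0, one_mul]
            refine hs1.le.trans ?_
            rw [div_le_one (by positivity)]
            linarith
          · exact Finset.one_le_prod fun k hk => by
              exact_mod_cast hm k (Finset.mem_Icc.mp hk).2
        have h1 : 1 ≤ ε ^ (2 * ℓ) * (2 / ε) ^ (2 * ℓ ^ 2) := by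
          have h2 : (1 / ε) ^ (2 * ℓ) ≤ (2 / ε) ^ (2 * ℓ ^ 2) :=
            calc (1 / ε) ^ (2 * ℓ) ≤ (1 / ε) ^ (2 * ℓ ^ 2) :=
                  pow_le_pow_right₀ hε1 (by nlinarith)
              _ ≤ _ := by
                gcongr
                norm_num
          have h3 := mul_le_mul_of_nonneg_left h2 (by positivity : 0 ≤ ε ^ (2 * ℓ))
          rwa [← mul_pow, mul_one_div_cancel hε.ne', one_pow] at h3
        have h4 := mul_le_mul_of_nonneg_left (hlarge k hk) (sq_nonneg γ)
        refine le_trans ?_ h4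
        have h5 : γ ^ 2 * (96 * κ ^ 2 * (2 / ε) ^ (2 * ℓ ^ 2) *
              Real.log (1 / lamStar * ∏ i ∈ Finset.Icc 1 ℓ, (m i : ℝ)))
            = ε ^ (2 * ℓ) * (2 / ε) ^ (2 * ℓ ^ 2) *
              (96 * Real.log (1 / lamStar * ∏ i ∈ Finset.Icc 1 ℓ, (m i : ℝ))) := by
          have hκ0 : κ ≠ 0 := by positivity
          have h6 : γ ^ 2 * κ ^ 2 = ε ^ (2 * ℓ) := by
            rw [hγ, div_pow, div_mul_cancel₀ _ (pow_ne_zero 2 hκ0), ← pow_mul, mul_comm]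
          rw [← h6]
          ring
        rw [h5]
        exact le_mul_of_one_le_left (by positivity) h1
      · have : ¬ ∃ x, 2 ^ (ℓ + 2) * γ < outSign b i * N.normValue x (ℓ + 1) i := by
          simpa [B] using hi
        exact not_lt.mp fun h => this ⟨x, h⟩
    have hBγ : γ * m (ℓ + 1) < B.card := by
      refine lt_of_le_of_lt ?_ hB
      gcongr
      linarith
    refine QueryAlg.le_answerProb_sampleThen hrun ((freq_mono fun ω hω => ?_).trans
      ((N.freq_noViolation_le b hm' hs₀ hs₀₁ hγ0 (by linarith) B hBγ
        fun i hi => (Finset.mem_filter.mp hi).2).trans hsound))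
    simpa using hω
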